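/- **Lemma (trace of the Fourier transform).** Let $U$ be a compact connected Lie group, let $\theta$ be an involutive automorphism of $U$ (that is, $\theta^2=\mathrm{id}$), and let $K$ be a closed subgroup with $(U^\theta)_0\subseteq K\subseteq U^\theta$, where $U^\theta$ is the fixed-point group of $\theta$ and $(U^\theta)_0$ its identity component (for instance $U=SU(p+q)$ and $K=S(U(p)\times U(q))$, $p\ge q\ge 1$). Let $\mu_U,\mu_K$ be the normalized Haar measures of $U$ and $K$, and let $\chi:K\to\mathbb{C}^\times$ be a continuous character (for a compact irreducible Hermitian symmetric pair these are the characters $\chi_l$, $l\in\mathbb{Z}$). For $a_1,\dots,a_r\in U$ let $\mu_{a_1,\dots,a_r,\chi}$ be the complex Borel measure on $U$ that represents the functional $$\varphi\mapsto\int_K\cdots\int_K \varphi(k_1a_1k_2\cdots k_ra_rk_{r+1})\,\chi(k_1\cdots k_{r+1})^{-1}\,d\mu_K(k_1)\cdots d\mu_K(k_{r+1})$$ on the continuous functions $\varphi:U\to\mathbb{C}$. Suppose that $\mu_{a_1,\dots,a_r,\chi}$ is absolutely continuous with respect to $\mu_U$, and let $f=f_{a_1,\dots,a_r,\chi}\in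 L^1(U,\mu_U)$ be its Radon–Nikodym derivative, $f\,d\mu_U=d\mu_{a_1,\dots,a_r,\chi}$. Let $(\pi_\lambda,E_\lambda)$ be a finite-dimensional irreducible unitary (continuous) representation of $U$, with inner product $(\cdot,\cdot)_\lambda$ linear in the first variable, that is $\chi$-spherical: there is a unit vector $e\in E_\lambda$ with $\pi_\lambda(k)e=\chi(k)e$ for all $k\in K$. Put $\psi_{\lambda,\chi}(u)=(e,\pi_\lambda(u)e)_\lambda$ for $u\in U$, the $\chi$-spherical function of $\pi_\lambda$, and $\mathcal{F}(f)(\lambda)=\int_U f(u)\,\pi_\lambda(u)\,d\mu_U(u)\in\mathrm{End}(E_\lambda)$. Then $$\mathrm{Tr}\big(\mathcal{F}(f_{a_1,\dots,a_r,\chi})(\lambda)\big)=\prod_{i=1}^r\psi_{\lambda,\chi}(a_i^{-1}).$$ -/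

import Mathlib

open MeasureTheory
open scoped Manifold ContDiff

/-- `(U, K)` is a symmetric pair with respect to the involution `θ` of the Lie group `U`: `θ` is an
involutive (smooth) automorphism of `U` and `K` is a closed subgroup with
`(U^θ)₀ ⊆ K ⊆ U^θ`, where `U^θ` is the fixed-point group of `θ` and `(U^θ)₀` is its identity
component. -/
structure IsSymmetricPair {V U : Type*} [NormedAddCommGroup V] [NormedSpace ℝ V]
    [TopologicalSpace U] [ChartedSpace V U] [Group U] (θ : U →* U) (K : Subgroup U) : Prop where
  contMDiff : ContMDiff 𝓘(ℝ, V) 𝓘(ℝ, V) ∞ (θ : U → U)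
  involutive : Function.Involutive (θ : U → U)
  isClosed : IsClosed (K : Set U)
  le_fixed : ∀ k ∈ K, θ k = k
  identityComponent_le : connectedComponentIn {u : U | θ u = u} 1 ⊆ (K : Set U)

section Representation

variable {U E : Type*} [Group U] [NormedAddCommGroup E] [InnerProductSpace ℂ E]

/-- `π` is an irreducible unitary (strongly continuous) representation of `U` on `E`. -/
structure IsIrreducibleUnitary [TopologicalSpace U] (π : Representation ℂ U E) : Prop where
  irreducible : π.IsIrreducible
  unitary : ∀ (u : U) (v w : E),
    @inner ℂ E InnerProductSpace.toInner (π u v) (π u w) = @inner ℂ E InnerProductSpace.toInner v w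
  continuous : ∀ v : E, Continuous fun u : U => π u v

/-- The subspace `{v ∈ E | π(k) v = χ(k) v for all k ∈ K}`. -/
def chiSubspace {K : Subgroup U} (χ : K →* ℂ) (π : Representation ℂ U E) : Submodule ℂ E where
  carrier := {v | ∀ k : K, π (k : U) v = χ k • v}
  add_mem' := by
    intro v w hv hw k
    rw [map_add, hv k, hw k, smul_add]
  zero_mem' := by
    intro k
    simp
  smul_mem' := by
    intro c v hv k
    rw [map_smul, hv k, smul_comm]

/-- The function `ψ(u) = (e, π(u) e)`, for the inner product that is linear in its *first* entry;
Mathlib's `inner ℂ x y` is linear in `y`, so that `(x, y)` is `inner ℂ y x`. -/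
noncomputable def sphericalFunction (π : Representation ℂ U E) (e : E) (u : U) : ℂ :=
  @inner ℂ E InnerProductSpace.toInner (π u e) e

/-- The Fourier transform `∫_U f(u) π(u) dμ_U(u) ∈ End(E)` of `f` at `π`. -/
noncomputable def fourierTransform [FiniteDimensional ℂ E] [MeasurableSpace U] (μU : Measure U)
    (f : U → ℂ) (π : Representation ℂ U E) : E →L[ℂ] E :=
  ∫ u, f u • LinearMap.toContinuousLinearMap (π u) ∂μU

end Representation

section Orbital

variable {U : Type*} [Group U] {K : Subgroup U}

/-- The product `k₁ a₁ k₂ a₂ ⋯ k_r a_r k_{r+1}` in `U`. -/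
def orbitalWord {r : ℕ} (a : Fin r → U) (k : Fin (r + 1) → K) : U :=
  (List.ofFn fun i : Fin r => (k i.castSucc : U) * a i).prod * (k (Fin.last r) : U)

/-- The functional `I_{a₁,…,a_r,χ}(φ) =
∫_K ⋯ ∫_K φ(k₁ a₁ k₂ ⋯ k_r a_r k_{r+1}) χ(k₁ ⋯ k_{r+1})⁻¹ dμ_K(k₁) ⋯ dμ_K(k_{r+1})`. -/
noncomputable def orbitalFunctional [MeasurableSpace U] (μK : Measure K) (χ : K →* ℂ)
    {r : ℕ} (a : Fin r → U) (φ : U → ℂ) : ℂ :=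
  ∫ k : Fin (r + 1) → K, φ (orbitalWord a k) * (χ (List.ofFn k).prod)⁻¹
    ∂(Measure.pi fun _ => μK)

/-- The complex measure `μ` is the `χ`-orbital measure `μ_{a₁,…,a_r,χ}`, i.e. it represents the
functional `I_{a₁,…,a_r,χ}`: `∫_U φ dμ = I_{a₁,…,a_r,χ}(φ)` for all `φ ∈ C(U)`. -/
def IsOrbitalMeasure [TopologicalSpace U] [MeasurableSpace U] (μK : Measure K) (χ : K →* ℂ)
    {r : ℕ} (a : Fin r → U) (μ : ComplexMeasure U) : Prop :=
  ∀ φ : C(U, ℂ),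
    VectorMeasure.integral μ φ (ContinuousLinearMap.mul ℝ ℂ) = orbitalFunctional μK χ a φ

end Orbital

/-- `f` is a Radon-Nikodym derivative of the complex measure `μ` with respect to `ν`:
`f` is `ν`-integrable and `f dν = dμ`. -/
def IsRadonNikodymDeriv {U : Type*} [MeasurableSpace U] (f : U → ℂ) (μ : ComplexMeasure U)
    (ν : Measure U) : Prop :=
  Integrable f ν ∧ ν.withDensityᵥ f = μ

/-! ### Multiplicity one for symmetric algebras of operators -/

section Algebra

variable {E : Type*} [NormedAddCommGroup E] [InnerProductSpace ℂ E] [FiniteDimensional ℂ E]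
  [CompleteSpace E]

set_option linter.unusedSectionVars false

/-! Pairing the orbital measure with the continuous function `Tr π` turns the trace of the Fourier
transform into the trace of the integral of `χ⁻¹ π` over all orbital words. By Fubini this operator
is `P π(a₁) P ⋯ π(a_r) P`, where `P = ∫_K χ⁻¹ π` (`integral_orbitalWord`). If the `χ`-vectors form a
line, `P` is the rank-one projection onto `e` (`integral_inv_smul_toCLM`). Hence `P π(a) P` is `P`
times a matrix coefficient of `e`, the product collapses to scalars times one `P`, and `Tr P = 1`.

The substance is therefore multiplicity one, `finrank_chiSubspace_le_one`, proved infinitesimally.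
Let `ρ = (π, π ∘ θ)`. It is differentiable (`differentiableAt_comp_chartInv`), and the complex span
`𝔤` of its differential is a Lie algebra stable under adjoints; `θ` becomes the interchange of
components. Connectedness of `U` makes `E` simple under `𝔤`, and the fixed part of the interchange
acts by scalars on the space `W` of `χ`-vectors.

An induction on dimension (`finrank_le_one_of_isSimpleFor`) then bounds `dim W`. Choose a
self-adjoint `H` in the `-1` part that does not act by a scalar, and let `T` be its top eigenspace.
A highest weight argument shows that `T` is simple under the centralizer of `H`; an Iwasawa-type
decomposition shows that `W` projects injectively to `T`. When every such `H` is scalar, every line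
in `W` is stable, so a nonzero `W` forces the module to be a line. -/

theorem IsSelfAdjoint.exists_spectral_resolution {T : E →L[ℂ] E} (hT : IsSelfAdjoint T) :
    ∃ (n : ℕ) (r : Fin n → E →L[ℂ] E) (l : Fin n → ℝ), ∑ i, r i = 1 ∧
      ∀ i, T * r i = (l i : ℂ) • r i ∧ r i * T = (l i : ℂ) • r i := by
  have hs : (T : E →ₗ[ℂ] E).IsSymmetric :=
    ContinuousLinearMap.isSelfAdjoint_iff_isSymmetric.mp hT
  let b := hs.eigenvectorBasis rfl
  refine ⟨_, fun i => InnerProductSpace.rankOne ℂ (b i) (b i), hs.eigenvalues rfl,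
    b.sum_rankOne_eq_id, fun i => ?_⟩
  have hb : T (b i) = (hs.eigenvalues rfl i : ℂ) • b i := hs.apply_eigenvectorBasis rfl i
  constructor
  · ext v
    simp [hb, smul_comm (inner ℂ (b i) v)]
  · ext v
    have : inner ℂ (b i) (T v) = (hs.eigenvalues rfl i : ℂ) * inner ℂ (b i) v := by
      rw [← ContinuousLinearMap.coe_coe, ← hs, ContinuousLinearMap.coe_coe, hb, inner_smul_left,
        Complex.conj_ofReal]
    simp [this, mul_smul]

theorem IsSelfAdjoint.exists_spectral_resolution_prod {H : (E →L[ℂ] E) × (E →L[ℂ] E)}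
    (hH : IsSelfAdjoint H) :
    ∃ (ι : Type) (_ : Fintype ι) (r : ι → (E →L[ℂ] E) × (E →L[ℂ] E)) (l : ι → ℝ), ∑ i, r i = 1 ∧
      ∀ i, H * r i = (l i : ℂ) • r i ∧ r i * H = (l i : ℂ) • r i := by
  obtain ⟨n, r, l, hr, h⟩ :=
    IsSelfAdjoint.exists_spectral_resolution (T := H.1) (congrArg Prod.fst hH)
  obtain ⟨n', r', l', hr', h'⟩ :=
    IsSelfAdjoint.exists_spectral_resolution (T := H.2) (congrArg Prod.snd hH)
  refine ⟨Fin n ⊕ Fin n', inferInstance, Sum.elim (fun i => (r i, 0)) (fun i => (0, r' i)),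
    Sum.elim l l', ?_, ?_⟩
  · ext1 <;> simp [Fintype.sum_sum_type, Prod.fst_sum, Prod.snd_sum, hr, hr']
  · rintro (i | i)
    · constructor <;> ext1 <;> simp [h i]
    · constructor <;> ext1 <;> simp [h' i]

/-- The inner derivation `X ↦ H X - X H` of an algebra. -/
def innerDerivation {A : Type*} [Ring A] [Algebra ℂ A] (H : A) : Module.End ℂ A :=
  LinearMap.mulLeft ℂ H - LinearMap.mulRight ℂ H

theorem innerDerivation_apply {A : Type*} [Ring A] [Algebra ℂ A] (H X : A) :
    innerDerivation H X = H * X - X * H := rfl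

/-- The blocks `r i * X * r j` are eigenvectors of `ad H` with the real eigenvalues `l i - l j`, and
they sum to `X`. So `ad H` is diagonalizable, and an `ad H`-stable subspace inherits the
decomposition. -/
theorem le_iSup_inf_eigenspace_innerDerivation {A : Type*} [Ring A] [Algebra ℂ A]
    [FiniteDimensional ℂ A] {H : A} {ι : Type} [Fintype ι] {r : ι → A} {l : ι → ℝ}
    (hr : ∑ i, r i = 1) (h : ∀ i, H * r i = (l i : ℂ) • r i ∧ r i * H = (l i : ℂ) • r i)
    {p : Submodule ℂ A} (hp : ∀ X ∈ p, H * X - X * H ∈ p) :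
    p ≤ ⨆ μ : ℝ, p ⊓ (innerDerivation H).eigenspace (μ : ℂ) := by
  have key : ∀ (X : A) (i j : ι), innerDerivation H (r i * X * r j)
      = ((l i : ℂ) - l j) • (r i * X * r j) := fun X i j => by
    rw [innerDerivation_apply, mul_assoc (r i * X), (h j).2, ← mul_assoc, ← mul_assoc, (h i).1,
      sub_smul]
    simp [mul_assoc]
  have expand : ∀ X : A, X = ∑ i, ∑ j, r i * X * r j := fun X => by
    simp_rw [← Finset.mul_sum, hr, mul_one, ← Finset.sum_mul, hr, one_mul]
  have htop : ⨆ μ, (innerDerivation H).genEigenspace μ 1 = ⊤ := by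
    refine eq_top_iff.mpr fun X _ => ?_
    rw [expand X]
    refine Submodule.sum_mem _ fun i _ => Submodule.sum_mem _ fun j _ => ?_
    refine Submodule.mem_iSup_of_mem ((l i : ℂ) - l j) ?_
    exact Module.End.mem_eigenspace_iff.mpr (key X i j)
  have hdec := Submodule.eq_iSup_inf_genEigenspace (p := p) (f := innerDerivation H) 1 hp htop
  rw [hdec]
  refine iSup_le fun μ => ?_
  rintro X ⟨hXp, hX⟩
  have hX' : innerDerivation H X = μ • X := Module.End.mem_eigenspace_iff.mp hX
  by_cases hμ : ∃ ν : ℝ, (ν : ℂ) = μ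
  · obtain ⟨ν, rfl⟩ := hμ
    rw [← hdec]
    exact Submodule.mem_iSup_of_mem ν ⟨hXp, hX⟩
  -- Compressing `[H, X] = μ X` to the block `(i, j)` gives `l i - l j = μ` unless that block of `X`
  -- vanishes; a non-real `μ` therefore kills every block.
  · have : X = 0 := by
      rw [expand X]
      refine Finset.sum_eq_zero fun i _ => Finset.sum_eq_zero fun j _ => ?_
      have h1 : r i * innerDerivation H X * r j = ((l i : ℂ) - l j) • (r i * X * r j) := by
        rw [← key, innerDerivation_apply, innerDerivation_apply]
        simp only [mul_sub, sub_mul]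
        rw [← mul_assoc (r i) H, ← mul_assoc H, ← mul_assoc H, (h i).1, (h i).2, ← mul_assoc,
          mul_assoc _ H, mul_assoc _ (r j) H, (h j).1, (h j).2]
      rw [hX', mul_smul_comm, smul_mul_assoc, ← sub_eq_zero, ← sub_smul, smul_eq_zero] at h1
      refine h1.resolve_left fun h0 => hμ ⟨l i - l j, ?_⟩
      rw [sub_eq_zero] at h0
      simpa using h0.symm
    rw [this]
    exact zero_mem _

/-- A complex Lie algebra of pairs of operators that is stable under the adjoint and under the
interchange of the two components. -/
structure IsSymmetricOperatorAlgebra (𝔤 : Submodule ℂ ((E →L[ℂ] E) × (E →L[ℂ] E))) : Prop where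
  bracket : ∀ X ∈ 𝔤, ∀ Y ∈ 𝔤, X * Y - Y * X ∈ 𝔤
  star : ∀ X ∈ 𝔤, star X ∈ 𝔤
  swap : ∀ X ∈ 𝔤, X.swap ∈ 𝔤

/-- The subspaces spanned by the products of at most `n` elements of `𝔤` applied to `G`. -/
def productSpan (𝔤 : Submodule ℂ ((E →L[ℂ] E) × (E →L[ℂ] E))) (G : Submodule ℂ E) :
    ℕ → Submodule ℂ E
  | 0 => G
  | n + 1 => productSpan 𝔤 G n ⊔
      Submodule.span ℂ {w | ∃ X ∈ 𝔤, ∃ v ∈ productSpan 𝔤 G n, w = X.1 v}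

/-- Commuting `X` past a factor `Y` costs only `[X, Y]`, which lies in `𝔤` and does not increase the
number of factors. -/
theorem productSpan_apply_mem {𝔤 : Submodule ℂ ((E →L[ℂ] E) × (E →L[ℂ] E))}
    (h𝔤 : IsSymmetricOperatorAlgebra 𝔤) {G : Submodule ℂ E} {X : (E →L[ℂ] E) × (E →L[ℂ] E)}
    (hX : X ∈ 𝔤) (hG : ∀ v ∈ G, X.1 v ∈ G) (n : ℕ) :
    ∀ v ∈ productSpan 𝔤 G n, X.1 v ∈ productSpan 𝔤 G n := by
  induction n with
  | zero => exact hG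
  | succ n ih =>
    suffices productSpan 𝔤 G (n + 1) ≤ (productSpan 𝔤 G (n + 1)).comap X.1.toLinearMap from
      fun v hv => this hv
    refine sup_le (fun v hv => ?_) (Submodule.span_le.mpr ?_)
    · change X.1 v ∈ productSpan 𝔤 G (n + 1)
      exact Submodule.mem_sup_left (ih v hv)
    rintro _ ⟨Y, hY, v, hv, rfl⟩
    have : X.1 (Y.1 v) = Y.1 (X.1 v) + (X * Y - Y * X).1 v := by simp
    change X.1 (Y.1 v) ∈ productSpan 𝔤 G (n + 1)
    rw [this]
    exact add_mem (Submodule.mem_sup_right (Submodule.subset_span ⟨Y, hY, _, ih v hv, rfl⟩))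
      (Submodule.mem_sup_right (Submodule.subset_span ⟨_, h𝔤.bracket X hX Y hY, v, hv, rfl⟩))

/-- `F` is a nonzero simple `𝔤`-module for the action through the first components. -/
structure IsSimpleFor (𝔤 : Submodule ℂ ((E →L[ℂ] E) × (E →L[ℂ] E))) (F : Submodule ℂ E) :
    Prop where
  stable : ∀ X ∈ 𝔤, ∀ v ∈ F, X.1 v ∈ F
  eq_of_stable : ∀ G ≤ F, G ≠ ⊥ → (∀ X ∈ 𝔤, ∀ v ∈ G, X.1 v ∈ G) → G = F

/-- By simplicity `G` generates `F`, so orthogonality to `D` can be propagated along the filtration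
by number of factors: in `X = Y + Z`, the summand `Y` preserves each filtration step, and `Z` is
moved to the other side of the inner product, where its adjoint preserves `D`. This serves twice
below, for the simplicity of the top eigenspace and for the injectivity of the projection to it. -/
theorem IsSimpleFor.inner_eq_zero {𝔤 : Submodule ℂ ((E →L[ℂ] E) × (E →L[ℂ] E))}
    (h𝔤 : IsSymmetricOperatorAlgebra 𝔤) {F : Submodule ℂ E} (hF : IsSimpleFor 𝔤 F)
    {G D : Submodule ℂ E} (hGF : G ≤ F) (hG : G ≠ ⊥)
    (hD : ∀ d ∈ D, ∀ v ∈ G, inner ℂ d v = 0)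
    (hdec : ∀ X ∈ 𝔤, ∃ Y ∈ 𝔤, ∃ Z ∈ 𝔤, X = Y + Z ∧ (∀ v ∈ G, Y.1 v ∈ G) ∧
      ∀ d ∈ D, (star Z).1 d ∈ D) :
    ∀ d ∈ D, ∀ v ∈ F, inner ℂ d v = 0 := by
  have h0 : ∀ n, productSpan 𝔤 G n ≤ F := fun n => by
    induction n with
    | zero => exact hGF
    | succ n ih =>
      refine sup_le ih (Submodule.span_le.mpr ?_)
      rintro _ ⟨Y, hY, v, hv, rfl⟩
      exact hF.stable Y hY v (ih hv)
  have h1 : (⨆ n, productSpan 𝔤 G n) = F := by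
    refine hF.eq_of_stable _ (iSup_le h0) (fun h => hG ?_) fun X hX v hv => ?_
    · exact le_bot_iff.mp ((le_iSup (productSpan 𝔤 G) 0).trans h.le)
    · suffices (⨆ n, productSpan 𝔤 G n) ≤
        (⨆ n, productSpan 𝔤 G n).comap X.1.toLinearMap from this hv
      refine iSup_le fun n v hv => Submodule.mem_iSup_of_mem (n + 1) ?_
      exact Submodule.mem_sup_right (Submodule.subset_span ⟨X, hX, v, hv, rfl⟩)
  have h2 : ∀ n, ∀ d ∈ D, ∀ v ∈ productSpan 𝔤 G n, inner ℂ d v = 0 := fun n => by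
    induction n with
    | zero => exact hD
    | succ n ih =>
      intro d hd
      suffices productSpan 𝔤 G (n + 1) ≤ (innerSL ℂ d).ker from fun v hv => this hv
      refine sup_le (fun v hv => ih d hd v hv) (Submodule.span_le.mpr ?_)
      rintro _ ⟨X, hX, v, hv, rfl⟩
      obtain ⟨Y, hY, Z, hZ, rfl, hYG, hZD⟩ := hdec X hX
      change inner ℂ d (Y.1 v + Z.1 v) = 0
      rw [inner_add_right, ih d hd _ (productSpan_apply_mem h𝔤 hY hYG n v hv), zero_add,
        ← ContinuousLinearMap.adjoint_inner_left]
      exact ih _ (hZD d hd) v hv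
  intro d hd
  suffices F ≤ (innerSL ℂ d).ker from fun v hv => this hv
  rw [← h1]
  exact iSup_le fun n v hv => h2 n d hd v hv

/-- `P`, `O`, `N` are the parts of positive, zero and negative `ad H`-weight. A positive weight
raises the eigenvalue of `H`, hence annihilates the top eigenspace. Both the adjoint (as `H` is
self-adjoint) and the interchange (as it negates `H`) reverse the sign of weights, so `star N` and
`N.swap` annihilate it too. -/
theorem exists_weight_decomposition {𝔤 : Submodule ℂ ((E →L[ℂ] E) × (E →L[ℂ] E))}
    (h𝔤 : IsSymmetricOperatorAlgebra 𝔤) {F : Submodule ℂ E}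
    (hF : ∀ X ∈ 𝔤, ∀ v ∈ F, X.1 v ∈ F) {H : (E →L[ℂ] E) × (E →L[ℂ] E)} (hH : H ∈ 𝔤)
    (hsa : IsSelfAdjoint H) (hswap : H.swap = -H) {l : ℝ}
    (hl : ∀ v ∈ F, v ≠ 0 → ∀ ν : ℝ, H.1 v = (ν : ℂ) • v → ν ≤ l) :
    ∀ X ∈ 𝔤, ∃ P ∈ 𝔤, ∃ O ∈ 𝔤, ∃ N ∈ 𝔤, X = P + O + N ∧ H * O = O * H ∧
      (∀ v ∈ F, H.1 v = (l : ℂ) • v → P.1 v = 0) ∧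
      (∀ v ∈ F, H.1 v = (l : ℂ) • v → (star N).1 v = 0) ∧
      (∀ v ∈ F, H.1 v = (l : ℂ) • v → N.swap.1 v = 0) := by
  have kill : ∀ X ∈ 𝔤, ∀ μ : ℝ, 0 < μ → H * X - X * H = (μ : ℂ) • X →
      ∀ v ∈ F, H.1 v = (l : ℂ) • v → X.1 v = 0 := by
    intro X hX μ hμ hHX v hv hHv
    by_contra hne
    have h1 : H.1 (X.1 v) - X.1 (H.1 v) = (μ : ℂ) • X.1 v :=
      congrArg (fun Y : (E →L[ℂ] E) × (E →L[ℂ] E) => Y.1 v) hHX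
    have h2 : H.1 (X.1 v) = ((l + μ : ℝ) : ℂ) • X.1 v := by
      rw [sub_eq_iff_eq_add] at h1
      rw [h1, hHv, map_smul]
      push_cast
      rw [add_smul, add_comm]
    have := hl _ (hF X hX v hv) hne _ h2
    linarith
  obtain ⟨ι, _, r, m, hr, h⟩ := hsa.exists_spectral_resolution_prod
  intro X hX
  replace hX := le_iSup_inf_eigenspace_innerDerivation hr h (p := 𝔤)
    (fun X hX => h𝔤.bracket H hH X hX) hX
  induction hX using Submodule.iSup_induction' with
  | mem μ X hX =>
    obtain ⟨hX𝔤, hX⟩ := hX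
    have hX : H * X - X * H = (μ : ℂ) • X := Module.End.mem_eigenspace_iff.mp hX
    rcases lt_trichotomy μ 0 with hμ | rfl | hμ
    · refine ⟨0, zero_mem _, 0, zero_mem _, X, hX𝔤, by simp, by simp, by simp,
        kill _ (h𝔤.star X hX𝔤) (-μ) (by linarith) ?_,
        kill _ (h𝔤.swap X hX𝔤) (-μ) (by linarith) ?_⟩
      · have := congrArg star hX
        rw [star_sub, star_mul, star_mul, hsa.star_eq, star_smul] at this
        rw [← neg_sub, this]
        simp
      · have h1 := congrArg Prod.swap hX
        have h2 : (H * X - X * H).swap = H.swap * X.swap - X.swap * H.swap := rfl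
        have h3 : ((μ : ℂ) • X).swap = (μ : ℂ) • X.swap := rfl
        rw [h2, h3, hswap] at h1
        simp only [neg_mul, mul_neg] at h1
        rw [Complex.ofReal_neg, neg_smul, ← h1]
        abel
    · refine ⟨0, zero_mem _, X, hX𝔤, 0, zero_mem _, by simp, ?_, by simp, by simp, by simp⟩
      simpa [sub_eq_zero] using hX
    · exact ⟨X, hX𝔤, 0, zero_mem _, 0, zero_mem _, by simp, by simp, kill X hX𝔤 μ hμ hX,
        by simp, by simp⟩
  | zero =>
    exact ⟨0, zero_mem _, 0, zero_mem _, 0, zero_mem _, by simp, by simp, by simp, by simp,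
      by simp⟩
  | add X Y _ _ hX hY =>
    obtain ⟨P, hP, O, hO, N, hN, rfl, h1, h2, h3, h4⟩ := hX
    obtain ⟨P', hP', O', hO', N', hN', rfl, h1', h2', h3', h4'⟩ := hY
    refine ⟨P + P', add_mem hP hP', O + O', add_mem hO hO', N + N', add_mem hN hN', by abel,
      by rw [mul_add, add_mul, h1, h1'], fun v hv hHv => ?_, fun v hv hHv => ?_,
      fun v hv hHv => ?_⟩
    · change P.1 v + P'.1 v = 0
      rw [h2 v hv hHv, h2' v hv hHv, add_zero]
    · rw [star_add]
      change (star N).1 v + (star N').1 v = 0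
      rw [h3 v hv hHv, h3' v hv hHv, add_zero]
    · change N.swap.1 v + N'.swap.1 v = 0
      rw [h4 v hv hHv, h4' v hv hHv, add_zero]

theorem exists_max_eigenvalue {T : E →L[ℂ] E} (hT : IsSelfAdjoint T) {F : Submodule ℂ E}
    (hF : F ≠ ⊥) (hTF : ∀ v ∈ F, T v ∈ F) :
    ∃ l : ℝ, (∃ v ∈ F, v ≠ 0 ∧ T v = (l : ℂ) • v) ∧
      ∀ v ∈ F, v ≠ 0 → ∀ ν : ℝ, T v = (ν : ℂ) • v → ν ≤ l := by
  have hs : (T : E →ₗ[ℂ] E).IsSymmetric :=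
    ContinuousLinearMap.isSelfAdjoint_iff_isSymmetric.mp hT
  let S : Set ℝ := {ν | ∃ v ∈ F, v ≠ 0 ∧ T v = (ν : ℂ) • v}
  have hfin : S.Finite := by
    have h1 : (Complex.ofReal ⁻¹' {μ | Module.End.HasEigenvalue (T : E →ₗ[ℂ] E) μ}).Finite :=
      (Module.End.finite_hasEigenvalue _).preimage Complex.ofReal_injective.injOn
    refine h1.subset ?_
    rintro ν ⟨v, _, hv0, hv⟩
    exact Module.End.hasEigenvalue_of_hasEigenvector ⟨Module.End.mem_eigenspace_iff.mpr hv, hv0⟩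
  have hne : S.Nonempty := by
    have : Nontrivial F := Submodule.nontrivial_iff_ne_bot.mpr hF
    obtain ⟨μ, hμ⟩ := Module.End.exists_eigenvalue ((T : E →ₗ[ℂ] E).restrict hTF)
    obtain ⟨v, hv⟩ := hμ.exists_hasEigenvector
    have hv1 : T v = μ • (v : E) := congrArg Subtype.val (Module.End.mem_eigenspace_iff.mp hv.1)
    have hv0 : (v : E) ≠ 0 := fun h => hv.2 (Subtype.ext h)
    have hconj := hs.conj_eigenvalue_eq_self
      (Module.End.hasEigenvalue_of_hasEigenvector ⟨Module.End.mem_eigenspace_iff.mpr hv1, hv0⟩)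
    obtain ⟨ν, hν⟩ := Complex.conj_eq_iff_real.mp hconj
    exact ⟨ν, v, v.2, hv0, hν ▸ hv1⟩
  obtain ⟨l, hl, hmax⟩ := Set.exists_max_image S id hfin hne
  exact ⟨l, hl, fun v hv hv0 ν hν => hmax ν ⟨v, hv, hv0, hν⟩⟩

/-- Base case of the induction. Splitting into self-adjoint parts makes the whole `-1` part scalar
on `F`; together with the fixed part, all of `𝔤` acts by scalars on `W`. Any line in `W` is then
stable, hence equal to `F`. -/
theorem finrank_le_one_of_forall_scalar {𝔤 : Submodule ℂ ((E →L[ℂ] E) × (E →L[ℂ] E))}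
    (h𝔤 : IsSymmetricOperatorAlgebra 𝔤) {F W : Submodule ℂ E} (hF : IsSimpleFor 𝔤 F) (hWF : W ≤ F)
    (hW : ∀ X ∈ 𝔤, X.swap = X → ∃ c : ℂ, ∀ w ∈ W, X.1 w = c • w)
    (hscalar : ∀ H ∈ 𝔤, IsSelfAdjoint H → H.swap = -H → ∃ c : ℂ, ∀ v ∈ F, H.1 v = c • v) :
    Module.finrank ℂ W ≤ 1 := by
  have hp : ∀ X ∈ 𝔤, X.swap = -X → ∃ c : ℂ, ∀ v ∈ F, X.1 v = c • v := by
    intro X hX hsw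
    have hsw' : (star X).swap = - star X := by
      have : (star X).swap = star X.swap := rfl
      rw [this, hsw, star_neg]
    obtain ⟨c, hc⟩ := hscalar (X + star X) (add_mem hX (h𝔤.star X hX))
      (IsSelfAdjoint.add_star_self X) (by
        change X.swap + (star X).swap = _
        rw [hsw, hsw', neg_add])
    obtain ⟨d, hd⟩ := hscalar (Complex.I • (X - star X))
      (𝔤.smul_mem _ (sub_mem hX (h𝔤.star X hX))) (by
        rw [IsSelfAdjoint, star_smul, star_sub, star_star]
        simp only [Complex.star_def, Complex.conj_I]
        rw [neg_smul, ← smul_neg, neg_sub]) (by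
        change Complex.I • (X.swap - (star X).swap) = _
        rw [hsw, hsw', ← smul_neg]
        congr 1
        abel)
    -- `X + X* = c` and `i (X - X*) = d` on `F` give `2X = c - i d`.
    refine ⟨(c - Complex.I * d) / 2, fun v hv => ?_⟩
    have h1 : X.1 v + (star X).1 v = c • v := hc v hv
    have h2 : Complex.I • (X.1 v - (star X).1 v) = d • v := hd v hv
    have h3 : X.1 v - (star X).1 v = (-Complex.I * d) • v := by
      rw [mul_smul, ← h2, smul_smul]
      simp
    have h4 : (2 : ℂ) • X.1 v = (c - Complex.I * d) • v := by
      rw [sub_smul, ← h1, two_smul, sub_eq_add_neg, ← neg_smul, ← neg_mul, ← h3]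
      abel
    rw [div_eq_inv_mul, mul_smul, ← h4, smul_smul]
    simp
  have hall : ∀ X ∈ 𝔤, ∃ c : ℂ, ∀ w ∈ W, X.1 w = c • w := by
    intro X hX
    obtain ⟨c, hc⟩ := hW (X + X.swap) (add_mem hX (h𝔤.swap X hX)) (by
      change X.swap + X.swap.swap = _
      rw [Prod.swap_swap, add_comm])
    obtain ⟨d, hd⟩ := hp (X - X.swap) (sub_mem hX (h𝔤.swap X hX)) (by
      change X.swap - X.swap.swap = _
      rw [Prod.swap_swap, neg_sub])
    refine ⟨(c + d) / 2, fun w hw => ?_⟩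
    have h1 : X.1 w + X.swap.1 w = c • w := hc w hw
    have h2 : X.1 w - X.swap.1 w = d • w := hd w (hWF hw)
    have h4 : (2 : ℂ) • X.1 w = (c + d) • w := by
      rw [add_smul, ← h1, ← h2, two_smul]
      abel
    rw [div_eq_inv_mul, mul_smul, ← h4, smul_smul]
    simp
  by_cases hbot : W = ⊥
  · rw [hbot, finrank_bot]
    exact zero_le_one
  obtain ⟨w, hw, hw0⟩ := Submodule.exists_mem_ne_zero_of_ne_bot hbot
  have hspan : Submodule.span ℂ {w} = F := by
    refine hF.eq_of_stable _ ?_ ?_ ?_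
    · exact (Submodule.span_singleton_le_iff_mem _ _).mpr (hWF hw)
    · simpa using hw0
    · intro X hX v hv
      obtain ⟨c, hc⟩ := hall X hX
      obtain ⟨a, rfl⟩ := Submodule.mem_span_singleton.mp hv
      rw [hc _ (W.smul_mem a hw)]
      exact Submodule.smul_mem _ _ hv
  calc Module.finrank ℂ W ≤ Module.finrank ℂ F := Submodule.finrank_mono hWF
    _ = 1 := by rw [← hspan, finrank_span_singleton hw0]

/-- Multiplicity one: a simple module over a symmetric algebra of operators contains at most one
line on which the fixed points of the interchange act by scalars. -/
theorem finrank_le_one_of_isSimpleFor (n : ℕ) :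
    ∀ {𝔤 : Submodule ℂ ((E →L[ℂ] E) × (E →L[ℂ] E))}, IsSymmetricOperatorAlgebra 𝔤 →
    ∀ {F W : Submodule ℂ E}, Module.finrank ℂ F = n → IsSimpleFor 𝔤 F → W ≤ F →
    (∀ X ∈ 𝔤, X.swap = X → ∃ c : ℂ, ∀ w ∈ W, X.1 w = c • w) → Module.finrank ℂ W ≤ 1 := by
  induction n using Nat.strong_induction_on with
  | _ n ih =>
  intro 𝔤 h𝔤 F W hn hF hWF hW
  by_cases hscalar : ∀ H ∈ 𝔤, IsSelfAdjoint H → H.swap = -H → ∃ c : ℂ, ∀ v ∈ F, H.1 v = c • v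
  · exact finrank_le_one_of_forall_scalar h𝔤 hF hWF hW hscalar
  push Not at hscalar
  obtain ⟨H, hH, hsa, hswap, hns⟩ := hscalar
  have hF0 : F ≠ ⊥ := by
    rintro rfl
    obtain ⟨v, hv, hne⟩ := hns 0
    exact hne (by simp [(Submodule.mem_bot ℂ).mp hv])
  have hsa1 : IsSelfAdjoint H.1 := congrArg Prod.fst hsa
  obtain ⟨l, ⟨v₀, hv₀F, hv₀, hHv₀⟩, hl⟩ := exists_max_eigenvalue hsa1 hF0 (hF.stable H hH)
  -- `T` is the top eigenspace of `H` in `F`. It is proper because `H` is not scalar on `F`, so the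
  -- induction applies to it with the centralizer `𝔤₀` of `H` in place of `𝔤`.
  let T : Submodule ℂ E := F ⊓ Module.End.eigenspace (H.1 : E →ₗ[ℂ] E) (l : ℂ)
  have memT : ∀ v, v ∈ T ↔ v ∈ F ∧ H.1 v = (l : ℂ) • v := fun v => by
    rw [Submodule.mem_inf, Module.End.mem_eigenspace_iff, ContinuousLinearMap.coe_coe]
  have hT0 : T ≠ ⊥ := fun h => hv₀ (by
    have : v₀ ∈ T := (memT _).mpr ⟨hv₀F, hHv₀⟩
    rwa [h, Submodule.mem_bot] at this)
  have hTF : T < F := by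
    refine lt_of_le_of_ne inf_le_left fun h => ?_
    obtain ⟨v, hv, hne⟩ := hns l
    exact hne ((memT v).mp (h ▸ hv)).2
  have hdec := exists_weight_decomposition h𝔤 hF.stable hH hsa hswap hl
  let 𝔤₀ : Submodule ℂ ((E →L[ℂ] E) × (E →L[ℂ] E)) := 𝔤 ⊓ (innerDerivation H).ker
  have mem𝔤₀ : ∀ X, X ∈ 𝔤₀ ↔ X ∈ 𝔤 ∧ H * X = X * H := fun X => by
    simp [𝔤₀, innerDerivation_apply, sub_eq_zero]
  have h𝔤₀ : IsSymmetricOperatorAlgebra 𝔤₀ := by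
    constructor
    · intro X hX Y hY
      rw [mem𝔤₀] at *
      refine ⟨h𝔤.bracket X hX.1 Y hY.1, ?_⟩
      have hc : Commute H (X * Y - Y * X) :=
        (Commute.mul_right hX.2 hY.2).sub_right (Commute.mul_right hY.2 hX.2)
      exact hc
    · intro X hX
      rw [mem𝔤₀] at *
      refine ⟨h𝔤.star X hX.1, ?_⟩
      have := congrArg star hX.2
      rw [star_mul, star_mul, hsa.star_eq] at this
      exact this.symm
    · intro X hX
      rw [mem𝔤₀] at *
      refine ⟨h𝔤.swap X hX.1, ?_⟩
      have h1 : H.swap * X.swap = X.swap * H.swap := congrArg Prod.swap hX.2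
      rw [hswap] at h1
      simpa using h1
  have hT𝔤₀ : ∀ X ∈ 𝔤₀, ∀ v ∈ T, X.1 v ∈ T := by
    intro X hX v hv
    rw [mem𝔤₀] at hX
    rw [memT] at hv ⊢
    refine ⟨hF.stable X hX.1 v hv.1, ?_⟩
    have : H.1 (X.1 v) = X.1 (H.1 v) :=
      congrArg (fun Y : (E →L[ℂ] E) × (E →L[ℂ] E) => Y.1 v) hX.2
    rw [this, hv.2, map_smul]
  have hT : IsSimpleFor 𝔤₀ T := by
    -- For a `𝔤₀`-stable `G` in `T`, split `X = P + (O + N)`: `P` kills `G`, while `(O + N)*` acts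
    -- on the complement of `G` in `T` through `O*` alone and preserves it. That complement is then
    -- orthogonal to all of `F`, itself included, hence zero.
    refine ⟨hT𝔤₀, fun G hGT hG hGst => ?_⟩
    have hD := hF.inner_eq_zero h𝔤 (G := G) (D := Gᗮ ⊓ T) (hGT.trans hTF.le) hG
      (fun d hd v hv => Submodule.inner_left_of_mem_orthogonal hv hd.1) (fun X hX => by
        obtain ⟨P, hP, O, hO, N, hN, rfl, h1, h2, h3, -⟩ := hdec X hX
        refine ⟨P, hP, O + N, add_mem hO hN, add_assoc _ _ _, fun v hv => ?_, fun d hd => ?_⟩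
        · have := (memT v).mp (hGT hv)
          rw [h2 v this.1 this.2]
          exact zero_mem _
        · have hd' := (memT d).mp hd.2
          rw [star_add]
          change (star O).1 d + (star N).1 d ∈ _
          rw [h3 d hd'.1 hd'.2, add_zero]
          have hO₀ : O ∈ 𝔤₀ := (mem𝔤₀ O).mpr ⟨hO, h1⟩
          refine ⟨fun v hv => ?_, hT𝔤₀ _ (h𝔤₀.star O hO₀) d hd.2⟩
          change inner ℂ v (ContinuousLinearMap.adjoint O.1 d) = 0
          rw [ContinuousLinearMap.adjoint_inner_right]
          exact Submodule.inner_right_of_mem_orthogonal (hGst O hO₀ v hv) hd.1)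
    have hbot : Gᗮ ⊓ T = ⊥ := by
      refine eq_bot_iff.mpr fun d hd => ?_
      have := hD d hd d (hTF.le hd.2)
      exact inner_self_eq_zero.mp this
    have := Submodule.sup_orthogonal_inf_of_hasOrthogonalProjection hGT
    rwa [hbot, sup_bot_eq] at this
  have hinj : ∀ w ∈ W, (∀ v ∈ T, inner ℂ w v = 0) → w = 0 := by
    intro w hw hwT
    have hD := hF.inner_eq_zero h𝔤 (G := T) (D := W ⊓ Tᗮ) hTF.le hT0
      (fun d hd v hv => Submodule.inner_left_of_mem_orthogonal hv hd.2) (fun X hX => by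
        obtain ⟨P, hP, O, hO, N, hN, rfl, h1, h2, h3, h4⟩ := hdec X hX
        have hNs := h𝔤.swap N hN
        -- Iwasawa-type splitting: `N.swap` annihilates `T`, so the first summand preserves `T`. The
        -- second is fixed by the interchange, so its adjoint is scalar on `W` and preserves every
        -- subspace of `W`.
        refine ⟨P + O - N.swap, sub_mem (add_mem hP hO) hNs, N + N.swap, add_mem hN hNs, by abel,
          fun v hv => ?_, fun d hd => ?_⟩
        · have hv' := (memT v).mp hv
          change P.1 v + O.1 v - N.swap.1 v ∈ T
          rw [h2 v hv'.1 hv'.2, h4 v hv'.1 hv'.2, zero_add, sub_zero]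
          exact hT𝔤₀ O ((mem𝔤₀ O).mpr ⟨hO, h1⟩) v hv
        · obtain ⟨c, hc⟩ := hW (star (N + N.swap)) (h𝔤.star _ (add_mem hN hNs)) (by
            change star (N.swap + N.swap.swap) = _
            rw [Prod.swap_swap, add_comm])
          rw [hc d hd.1]
          exact Submodule.smul_mem _ _ hd)
    refine inner_self_eq_zero.mp (hD w ⟨hw, fun v hv => ?_⟩ w (hWF hw))
    exact inner_eq_zero_symm.mp (hwT v hv)
  let Q : E →ₗ[ℂ] E := T.starProjection.toLinearMap
  have hQT : ∀ w, Q w ∈ T := fun w => T.starProjection_apply_mem w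
  have hQinj : Function.Injective (Q.domRestrict W) := by
    rw [← LinearMap.ker_eq_bot, LinearMap.ker_eq_bot']
    rintro ⟨w, hw⟩ h
    have h : T.starProjection w = 0 := h
    refine Subtype.ext (hinj w hw fun v hv => ?_)
    have := T.starProjection_apply_eq_zero_iff.mp h
    exact Submodule.inner_left_of_mem_orthogonal hv this
  -- `T` is stable under `𝔤₀` and its adjoints, so the projection commutes with `𝔤₀`; the scalar
  -- action on `W` thus passes to its image in `T`.
  have hQ : ∀ X ∈ 𝔤₀, ∀ w, X.1 (Q w) = Q (X.1 w) := by
    intro X hX w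
    symm
    refine Submodule.eq_starProjection_of_mem_orthogonal (hT𝔤₀ X hX _ (hQT w)) ?_
    rw [← map_sub]
    intro v hv
    rw [← ContinuousLinearMap.adjoint_inner_left]
    exact T.sub_starProjection_mem_orthogonal w _ (hT𝔤₀ _ (h𝔤₀.star X hX) v hv)
  have hfin := ih _ (hn ▸ Submodule.finrank_lt_finrank_of_lt hTF) h𝔤₀ (F := T) (W := W.map Q)
    rfl hT (by rintro _ ⟨w, -, rfl⟩; exact hQT w) (fun X hX hsw => by
      obtain ⟨c, hc⟩ := hW X hX.1 hsw
      refine ⟨c, ?_⟩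
      rintro _ ⟨w, hw, rfl⟩
      rw [hQ X hX, hc w hw, map_smul])
  have : Module.finrank ℂ W = Module.finrank ℂ (W.map Q) := by
    rw [← LinearMap.finrank_range_of_inj hQinj, LinearMap.range_domRestrict]
  rwa [this]

end Algebra

theorem Continuous.integrable_of_compactSpace {X Y : Type*} [TopologicalSpace X] [CompactSpace X]
    [MeasurableSpace X] [OpensMeasurableSpace X] [NormedAddCommGroup Y]
    {μ : Measure X} [IsFiniteMeasureOnCompacts μ] [SecondCountableTopologyEither X Y]
    {f : X → Y} (hf : Continuous f) : Integrable f μ :=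
  hf.integrable_of_hasCompactSupport (HasCompactSupport.of_compactSpace f)

/-! ### Differentiability of continuous homomorphisms -/

section Smoothing

variable {V U : Type*} [NormedAddCommGroup V] [NormedSpace ℝ V] [FiniteDimensional ℝ V]
  [TopologicalSpace U] [ChartedSpace V U] [Group U] [LieGroup 𝓘(ℝ, V) ∞ U]

variable (V U) in
/-- The inverse of the preferred chart at the identity of a Lie group. -/
noncomputable def chartInv : V → U := (extChartAt 𝓘(ℝ, V) (1 : U)).symm

variable (V U) in
/-- The coordinates of the identity in the preferred chart. -/
noncomputable def chartBase : V := extChartAt 𝓘(ℝ, V) (1 : U) 1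

omit [FiniteDimensional ℝ V] [LieGroup 𝓘(ℝ, V) ∞ U] in
theorem chartInv_chartBase : chartInv V U (chartBase V U) = 1 := extChartAt_to_inv (I := 𝓘(ℝ, V)) 1

omit [FiniteDimensional ℝ V] in
theorem contMDiffAt_extChartAt_symm (u : U) :
    ContMDiffAt 𝓘(ℝ, V) 𝓘(ℝ, V) ∞ (extChartAt 𝓘(ℝ, V) u).symm (extChartAt 𝓘(ℝ, V) u u) :=
  have : IsManifold 𝓘(ℝ, V) ∞ U := LieGroup.toContMDiffMul.toIsManifold
  (contMDiffOn_extChartAt_symm u).contMDiffAt (extChartAt_target_mem_nhds u)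

omit [FiniteDimensional ℝ V] in
theorem contMDiffAt_chartInv :
    ContMDiffAt 𝓘(ℝ, V) 𝓘(ℝ, V) ∞ (chartInv V U) (chartBase V U) :=
  contMDiffAt_extChartAt_symm 1

omit [FiniteDimensional ℝ V] in
theorem contDiffAt_comp_inv_mul {g : U → ℝ} (hg : ContMDiff 𝓘(ℝ, V) 𝓘(ℝ, ℝ) ∞ g) (u : U) :
    ContDiffAt ℝ ∞ (fun p : V × V =>
      g ((chartInv V U p.1)⁻¹ * (extChartAt 𝓘(ℝ, V) u).symm p.2))
      (chartBase V U, extChartAt 𝓘(ℝ, V) u u) := by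
  rw [← contMDiffAt_iff_contDiffAt]
  have h1 : ContMDiffAt 𝓘(ℝ, V × V) 𝓘(ℝ, V) ∞ (fun p : V × V => chartInv V U p.1)
      (chartBase V U, extChartAt 𝓘(ℝ, V) u u) :=
    ContMDiffAt.comp (I' := 𝓘(ℝ, V)) _ contMDiffAt_chartInv contDiffAt_fst.contMDiffAt
  have h2 : ContMDiffAt 𝓘(ℝ, V × V) 𝓘(ℝ, V) ∞
      (fun p : V × V => (extChartAt 𝓘(ℝ, V) u).symm p.2)
      (chartBase V U, extChartAt 𝓘(ℝ, V) u u) :=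
    ContMDiffAt.comp (I' := 𝓘(ℝ, V)) (chartBase V U, extChartAt 𝓘(ℝ, V) u u)
      (contMDiffAt_extChartAt_symm u) contDiffAt_snd.contMDiffAt
  exact hg.contMDiffAt.comp _ (h1.inv.mul h2)

-- Near each point of `U` the function is `C¹` in both chart variables jointly, hence Lipschitz;
-- compactness of `U` makes the constant and the neighbourhood uniform. This is the domination
-- needed to differentiate under the integral.
omit [FiniteDimensional ℝ V] in
theorem exists_uniform_lipschitz_bound [CompactSpace U] {g : U → ℝ}
    (hg : ContMDiff 𝓘(ℝ, V) 𝓘(ℝ, ℝ) ∞ g) :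
    ∃ C : ℝ, ∃ s ∈ nhds (chartBase V U), ∀ u : U, ∀ x ∈ s,
      ‖g ((chartInv V U x)⁻¹ * u) - g ((chartInv V U (chartBase V U))⁻¹ * u)‖
        ≤ C * ‖x - chartBase V U‖ := by
  have := (isCompact_univ (X := U)).induction_on
    (p := fun S => ∃ C : ℝ, ∃ s ∈ nhds (chartBase V U), ∀ u ∈ S, ∀ x ∈ s,
      ‖g ((chartInv V U x)⁻¹ * u) - g ((chartInv V U (chartBase V U))⁻¹ * u)‖
        ≤ C * ‖x - chartBase V U‖) ⟨0, Set.univ, Filter.univ_mem, by simp⟩ ?_ ?_ ?_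
  · simpa using this
  · rintro S T hST ⟨C, s, hs, h⟩
    exact ⟨C, s, hs, fun u hu => h u (hST hu)⟩
  · rintro S T ⟨C, s, hs, h⟩ ⟨C', s', hs', h'⟩
    refine ⟨max C C', s ∩ s', Filter.inter_mem hs hs', ?_⟩
    rintro u (hu | hu) x hx
    · exact (h u hu x hx.1).trans (by gcongr; exact le_max_left _ _)
    · exact (h' u hu x hx.2).trans (by gcongr; exact le_max_right _ _)
  · intro u _
    obtain ⟨C, t, ht, hC⟩ := ((contDiffAt_comp_inv_mul hg u).of_le
      (by exact_mod_cast le_top : (1 : ℕ∞ω) ≤ ∞)).exists_lipschitzOnWith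
    rw [nhds_prod_eq] at ht
    obtain ⟨s, hs, s', hs', hss'⟩ := Filter.mem_prod_iff.mp ht
    refine ⟨(extChartAt 𝓘(ℝ, V) u).source ∩ extChartAt 𝓘(ℝ, V) u ⁻¹' s',
      mem_nhdsWithin_of_mem_nhds (Filter.inter_mem (extChartAt_source_mem_nhds u)
        ((continuousAt_extChartAt u).preimage_mem_nhds hs')), C, s, hs, ?_⟩
    rintro w ⟨hw, hw'⟩ x hx
    have := hC.norm_sub_le (hss' (Set.mk_mem_prod hx hw'))
      (hss' (Set.mk_mem_prod (mem_of_mem_nhds hs) hw'))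
    simpa only [(extChartAt 𝓘(ℝ, V) u).left_inv hw, Prod.mk_sub_mk, sub_self, Prod.norm_mk,
      norm_zero, max_eq_left (norm_nonneg _)] using this

omit [FiniteDimensional ℝ V] in
theorem differentiableAt_comp_inv_mul {g : U → ℝ} (hg : ContMDiff 𝓘(ℝ, V) 𝓘(ℝ, ℝ) ∞ g) (u : U) :
    DifferentiableAt ℝ (fun x : V => g ((chartInv V U x)⁻¹ * u)) (chartBase V U) := by
  have h : ContMDiffAt 𝓘(ℝ, V) 𝓘(ℝ, ℝ) ∞ (fun x : V => g ((chartInv V U x)⁻¹ * u))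
      (chartBase V U) :=
    hg.contMDiffAt.comp _ (contMDiffAt_chartInv.inv.mul contMDiffAt_const)
  exact h.contDiffAt.differentiableAt (by simp)

-- A directional derivative is a pointwise limit of a sequence of measurable difference quotients.
omit [FiniteDimensional ℝ V] in
theorem measurable_fderiv_of_measurable {X : Type*} [MeasurableSpace X] {F : V → X → ℝ} {x₀ : V}
    (hF : ∀ x, Measurable (F x)) (hd : ∀ u, DifferentiableAt ℝ (fun x => F x u) x₀) (v : V) :
    Measurable fun u => fderiv ℝ (fun x => F x u) x₀ v := by
  refine measurable_of_tendsto_metrizable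
    (f := fun (n : ℕ) u => (n : ℝ) • (F (x₀ + (n : ℝ)⁻¹ • v) u - F x₀ u)) (fun n => ?_) ?_
  · exact ((hF _).sub (hF _)).const_mul _
  · refine tendsto_pi_nhds.mpr fun u => ?_
    exact ((hd u).hasFDerivAt.lim_real v).comp tendsto_natCast_atTop_atTop

variable {B : Type*} [NormedRing B] [NormedAlgebra ℝ B] [CompleteSpace B]

omit [CompleteSpace B] in
theorem differentiableAt_integral_bump [CompactSpace U] [SecondCountableTopology U]
    [MeasurableSpace U] [BorelSpace U] (μ : Measure U) [IsFiniteMeasure μ]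
    {g : U → ℝ} (hg : ContMDiff 𝓘(ℝ, V) 𝓘(ℝ, ℝ) ∞ g) {ρ : U → B} (hρ : Continuous ρ) :
    DifferentiableAt ℝ (fun x : V => ∫ u, g ((chartInv V U x)⁻¹ * u) • ρ u ∂μ)
      (chartBase V U) := by
  have : IsTopologicalGroup U := topologicalGroup_of_lieGroup 𝓘(ℝ, V) ∞
  obtain ⟨C, s, hs, hC⟩ := exists_uniform_lipschitz_bound hg
  have hcont : ∀ x : V, Continuous fun u => g ((chartInv V U x)⁻¹ * u) := fun x =>
    hg.continuous.comp (continuous_const.mul continuous_id)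
  have hd := differentiableAt_comp_inv_mul hg
  let D : U → V →L[ℝ] ℝ := fun u => fderiv ℝ (fun x => g ((chartInv V U x)⁻¹ * u)) (chartBase V U)
  have hD : AEStronglyMeasurable D μ := by
    let b := Module.finBasis ℝ V
    have : D = fun u => ∑ i, D u (b i) • LinearMap.toContinuousLinearMap (b.coord i) := by
      ext u v
      have h : D u v = ∑ i, b.repr v i * D u (b i) := by
        conv_lhs => rw [← b.sum_repr v]
        rw [map_sum]
        simp only [map_smul, smul_eq_mul]
      simp [h, mul_comm]
    rw [this]
    refine Finset.aestronglyMeasurable_fun_sum _ fun i _ => ?_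
    refine AEStronglyMeasurable.smul_const ?_ _
    exact (measurable_fderiv_of_measurable (fun x => (hcont x).measurable) hd (b i)).aestronglyMeasurable
  refine (hasFDerivAt_integral_of_dominated_loc_of_lip' (F' := fun u => (D u).smulRight (ρ u))
    (bound := fun u => C * ‖ρ u‖) hs (fun x _ => ?_) ?_ ?_ (ae_of_all _ fun u x hx => ?_) ?_
    (ae_of_all _ fun u => ?_)).2.differentiableAt
  · exact ((hcont x).smul hρ).integrable_of_compactSpace.aestronglyMeasurable
  · exact ((hcont _).smul hρ).integrable_of_compactSpace
  · exact (ContinuousLinearMap.smulRightL ℝ V B).aestronglyMeasurable_comp₂ hD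
      hρ.integrable_of_compactSpace.aestronglyMeasurable
  · rw [← sub_smul, norm_smul]
    calc _ ≤ C * ‖x - chartBase V U‖ * ‖ρ u‖ := by gcongr; exact hC u x hx
      _ = _ := by ring
  · exact hρ.integrable_of_compactSpace.norm.const_mul C
  · exact (hd u).hasFDerivAt.smul_const (ρ u)

/-- A continuous homomorphism from a compact Lie group to the multiplicative monoid of a Banach
algebra is differentiable at the identity. -/
theorem differentiableAt_comp_chartInv [T2Space U] [CompactSpace U] [SecondCountableTopology U]
    [MeasurableSpace U] [BorelSpace U] (μ : Measure U) [μ.IsHaarMeasure]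
    (ρ : U →* B) (hρ : Continuous ρ) :
    DifferentiableAt ℝ (fun x : V => ρ (chartInv V U x)) (chartBase V U) := by
  have : IsManifold 𝓘(ℝ, V) ∞ U := LieGroup.toContMDiffMul.toIsManifold
  have : IsTopologicalGroup U := topologicalGroup_of_lieGroup 𝓘(ℝ, V) ∞
  have hnear : {u | ‖ρ u - 1‖ < 1 / 2} ∈ nhds (1 : U) := by
    refine IsOpen.mem_nhds (isOpen_lt (hρ.sub continuous_const).norm continuous_const) ?_
    simp
  -- Gårding's smoothing: `T = ∫ g ρ` lies within `c / 2` of the scalar `c = ∫ g`, because `ρ` is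
  -- within `1/2` of `1` on the support of `g`; so `T` is invertible.
  obtain ⟨g, -, hg⟩ := (SmoothBumpFunction.nhds_basis_support (I := 𝓘(ℝ, V)) hnear).mem_iff.mp hnear
  have hc : 0 < ∫ u, g u ∂μ :=
    g.continuous.integral_pos_of_hasCompactSupport_nonneg_nonzero
      (HasCompactSupport.of_compactSpace _) (fun u => g.nonneg) (x := 1) (by simp)
  set c := ∫ u, g u ∂μ
  set T := ∫ u, g u • ρ u ∂μ with hTdef
  have hT : IsUnit T := by
    have h1 : ‖T - c • 1‖ ≤ c * (1 / 2) := by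
      rw [← integral_smul_const, hTdef, ← integral_sub (f := fun u => g u • ρ u)
        (g := fun u => g u • (1 : B)) (g.continuous.smul hρ).integrable_of_compactSpace
        (g.continuous.smul continuous_const).integrable_of_compactSpace, ← integral_mul_const]
      refine norm_integral_le_of_norm_le (g.continuous.integrable_of_compactSpace.mul_const _)
        (ae_of_all _ fun u => ?_)
      rw [← smul_sub, norm_smul, Real.norm_of_nonneg g.nonneg]
      by_cases hu : u ∈ Function.support g
      · exact mul_le_mul_of_nonneg_left (hg hu).le g.nonneg
      · rw [Function.notMem_support.mp hu, zero_mul, zero_mul]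
    have h2 : ‖1 - c⁻¹ • T‖ < 1 := by
      have : (1 : B) - c⁻¹ • T = -(c⁻¹ • (T - c • 1)) := by
        rw [smul_sub, smul_smul, inv_mul_cancel₀ hc.ne', one_smul, neg_sub]
      rw [this, norm_neg, norm_smul, norm_inv, Real.norm_of_nonneg hc.le]
      calc c⁻¹ * ‖T - c • 1‖ ≤ c⁻¹ * (c * (1 / 2)) := by gcongr
        _ < 1 := by rw [inv_mul_cancel_left₀ hc.ne']; norm_num
    have h3 := isUnit_one_sub_of_norm_lt_one h2
    rw [sub_sub_cancel] at h3
    have h4 := h3.smul (Units.mk0 c hc.ne')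
    rwa [Units.smul_def, Units.val_mk0, smul_smul, mul_inv_cancel₀ hc.ne', one_smul] at h4
  obtain ⟨S, hS⟩ := hT.exists_right_inv
  -- Left invariance gives `ρ w * T = ∫ g (w⁻¹ u) ρ u`, which moves the dependence on `w` from `ρ`
  -- to the smooth function `g`.
  have hG : ∀ w : U, ρ w = (∫ u, g (w⁻¹ * u) • ρ u ∂μ) * S := by
    intro w
    have : ∫ u, g (w⁻¹ * u) • ρ u ∂μ = ρ w * T := by
      rw [← integral_mul_left_eq_self _ w, hTdef, ← integral_const_mul_of_integrable]
      · simp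
      · exact (g.continuous.smul hρ).integrable_of_compactSpace
    rw [this, mul_assoc, hS, mul_one]
  simp_rw [fun x : V => hG (chartInv V U x)]
  exact (differentiableAt_integral_bump μ g.contMDiff hρ).mul_const S

end Smoothing

/-! ### The differential at the identity: equivariance, brackets, commutants -/

section Infinitesimal

variable {V U : Type*} [NormedAddCommGroup V] [NormedSpace ℝ V]
  [TopologicalSpace U] [ChartedSpace V U] [Group U] [LieGroup 𝓘(ℝ, V) ∞ U]

variable (V) in
/-- The expression in the chart at the identity of a self-map of a Lie group. -/
noncomputable def chartMap (α : U → U) (x : V) : V :=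
  extChartAt 𝓘(ℝ, V) (1 : U) (α (chartInv V U x))

omit [LieGroup 𝓘(ℝ, V) ∞ U] in
theorem chartMap_eq_chartBase {α : U → U} {x : V} (h : α (chartInv V U x) = 1) :
    chartMap V α x = chartBase V U := by
  rw [chartMap, h, chartBase]

theorem contDiffAt_chartMap {α : U → U} (hα : ContMDiff 𝓘(ℝ, V) 𝓘(ℝ, V) ∞ α) {x : V}
    (hx : x ∈ (extChartAt 𝓘(ℝ, V) (1 : U)).target) (h : α (chartInv V U x) = 1) :
    ContDiffAt ℝ ∞ (chartMap V α) x := by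
  have : IsManifold 𝓘(ℝ, V) ∞ U := LieGroup.toContMDiffMul.toIsManifold
  rw [← contMDiffAt_iff_contDiffAt]
  have h1 : ContMDiffAt 𝓘(ℝ, V) 𝓘(ℝ, V) ∞ (chartInv V U) x :=
    (contMDiffOn_extChartAt_symm 1).contMDiffAt ((isOpen_extChartAt_target 1).mem_nhds hx)
  have h2 : ContMDiffAt 𝓘(ℝ, V) 𝓘(ℝ, V) ∞ (extChartAt 𝓘(ℝ, V) (1 : U)) (α (chartInv V U x)) := by
    rw [h]
    exact contMDiffAt_extChartAt
  exact h2.comp x (hα.contMDiffAt.comp x h1)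

omit [LieGroup 𝓘(ℝ, V) ∞ U] in
theorem chartInv_chartMap {α : U → U} (hα : Continuous α) {x : V}
    (hx : x ∈ (extChartAt 𝓘(ℝ, V) (1 : U)).target) (h : α (chartInv V U x) = 1) :
    ∀ᶠ y in nhds x, chartInv V U (chartMap V α y) = α (chartInv V U y) := by
  have h1 : ContinuousAt (chartInv V U) x :=
    (continuousOn_extChartAt_symm (I := 𝓘(ℝ, V)) (1 : U)).continuousAt
      ((isOpen_extChartAt_target 1).mem_nhds hx)
  have h2 : ContinuousAt (fun y => α (chartInv V U y)) x := hα.continuousAt.comp h1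
  have h3 : (extChartAt 𝓘(ℝ, V) (1 : U)).source ∈ nhds (α (chartInv V U x)) := by
    rw [h]
    exact extChartAt_source_mem_nhds (I := 𝓘(ℝ, V)) (1 : U)
  filter_upwards [h2 h3] with y hy
  exact (extChartAt 𝓘(ℝ, V) (1 : U)).left_inv hy

omit [LieGroup 𝓘(ℝ, V) ∞ U] in
theorem chartBase_mem_target : chartBase V U ∈ (extChartAt 𝓘(ℝ, V) (1 : U)).target :=
  mem_extChartAt_target 1

theorem Submodule.mem_of_hasFDerivAt {B : Type*} [NormedAddCommGroup B] [NormedSpace ℝ B]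
    {N : Submodule ℝ B} (hN : IsClosed (N : Set B)) {f : V → B} {f' : V →L[ℝ] B} {x : V}
    (hf : HasFDerivAt f f' x) (v : V) (h : ∀ᶠ t : ℝ in nhds 0, f (x + t • v) - f x ∈ N) :
    f' v ∈ N := by
  refine hN.mem_of_tendsto (hf.lim_real v) ?_
  filter_upwards [tendsto_inv_atTop_zero.eventually h] with t ht
  exact N.smul_mem t ht

variable {B : Type*} [NormedRing B] [NormedAlgebra ℝ B]

variable (V) in
/-- The differential at the identity of a homomorphism from a Lie group to the multiplicative
monoid of a Banach algebra, in the coordinates given by the chart at the identity. -/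
noncomputable def identityDifferential (ρ : U →* B) : V →L[ℝ] B :=
  fderiv ℝ (fun x => ρ (chartInv V U x)) (chartBase V U)

/-- The chain rule applied to `S ∘ ρ = ρ ∘ α`. It is used with conjugations of the group and with
the involution `θ`. -/
theorem map_identityDifferential {ρ : U →* B}
    (hρ : DifferentiableAt ℝ (fun x => ρ (chartInv V U x)) (chartBase V U))
    {α : U → U} (hα : ContMDiff 𝓘(ℝ, V) 𝓘(ℝ, V) ∞ α) (hα1 : α 1 = 1) {S : B →L[ℝ] B}
    (hS : ∀ u, S (ρ u) = ρ (α u)) (v : V) :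
    S (identityDifferential V ρ v) = identityDifferential V ρ (fderiv ℝ (chartMap V α) (chartBase V U) v) := by
  have h1 : α (chartInv V U (chartBase V U)) = 1 := by rw [chartInv_chartBase, hα1]
  have hτ := ((contDiffAt_chartMap hα chartBase_mem_target h1).differentiableAt
    (by simp)).hasFDerivAt
  have hτ0 := chartMap_eq_chartBase h1
  have h2 : HasFDerivAt (fun x => ρ (chartInv V U x)) (identityDifferential V ρ)
      (chartMap V α (chartBase V U)) := by
    rw [hτ0]
    exact hρ.hasFDerivAt
  have h3 := h2.comp _ hτ
  have h4 : HasFDerivAt (fun x => S (ρ (chartInv V U x))) (S.comp (identityDifferential V ρ))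
      (chartBase V U) := S.hasFDerivAt.comp _ hρ.hasFDerivAt
  have h5 : (fun x => S (ρ (chartInv V U x))) =ᶠ[nhds (chartBase V U)]
      (fun x => ρ (chartInv V U x)) ∘ chartMap V α := by
    filter_upwards [chartInv_chartMap hα.continuous chartBase_mem_target h1] with x hx
    rw [Function.comp_apply, hx, hS]
  exact congrArg (fun L : V →L[ℝ] B => L v) (h4.unique (h3.congr_of_eventuallyEq h5))

omit [LieGroup 𝓘(ℝ, V) ∞ U] in
theorem hasFDerivAt_comp_chartInv_inv [CompleteSpace B] {ρ : U →* B}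
    (hρ : DifferentiableAt ℝ (fun x => ρ (chartInv V U x)) (chartBase V U)) :
    HasFDerivAt (fun x => ρ (chartInv V U x)⁻¹) (-identityDifferential V ρ) (chartBase V U) := by
  have h1 : ∀ u : U, ρ u⁻¹ = Ring.inverse (ρ u) := fun u =>
    (Ring.inverse_unit (Units.map ρ (toUnits u))).symm
  have h2 : ρ (chartInv V U (chartBase V U)) = ((1 : Bˣ) : B) := by
    rw [chartInv_chartBase, map_one, Units.val_one]
  have h3 := hasFDerivAt_ringInverse (𝕜 := ℝ) (1 : Bˣ)
  rw [← h2] at h3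
  have h4 := h3.comp (chartBase V U) hρ.hasFDerivAt
  simp_rw [h1]
  refine h4.congr_fderiv ?_
  ext v
  simp [identityDifferential]

theorem contMDiff_conj (u : U) : ContMDiff 𝓘(ℝ, V) 𝓘(ℝ, V) ∞ fun w : U => u * w * u⁻¹ :=
  (contMDiff_const.mul contMDiff_id).mul contMDiff_const

theorem conj_identityDifferential_mem {ρ : U →* B}
    (hρ : DifferentiableAt ℝ (fun x => ρ (chartInv V U x)) (chartBase V U)) (u : U) {X : B}
    (hX : X ∈ (identityDifferential V ρ).range) : ρ u * X * ρ u⁻¹ ∈ (identityDifferential V ρ).range := by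
  obtain ⟨v, rfl⟩ := hX
  have := map_identityDifferential hρ (contMDiff_conj u) (by simp)
    (S := (ContinuousLinearMap.mul ℝ B).flip (ρ u⁻¹) ∘L ContinuousLinearMap.mul ℝ B (ρ u))
    (by simp) v
  exact ⟨_, this.symm⟩

omit [LieGroup 𝓘(ℝ, V) ∞ U] in
theorem hasFDerivAt_conj [CompleteSpace B] {ρ : U →* B}
    (hρ : DifferentiableAt ℝ (fun x => ρ (chartInv V U x)) (chartBase V U)) (Y : B) :
    ∃ L : V →L[ℝ] B, (∀ v, L v = identityDifferential V ρ v * Y - Y * identityDifferential V ρ v) ∧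
      HasFDerivAt (fun x => ρ (chartInv V U x) * Y * ρ (chartInv V U x)⁻¹) L (chartBase V U) := by
  refine ⟨_, fun v => ?_, (hρ.hasFDerivAt.mul_const' Y).mul' (hasFDerivAt_comp_chartInv_inv hρ)⟩
  simp [chartInv_chartBase, identityDifferential, sub_eq_neg_add]

/-- The bracket is the derivative of `ρ(u) Y ρ(u)⁻¹` at the identity, and this map takes values in
the range of the differential, which is closed because it is finite-dimensional. -/
theorem bracket_identityDifferential_mem [FiniteDimensional ℝ V] [CompleteSpace B] {ρ : U →* B}
    (hρ : DifferentiableAt ℝ (fun x => ρ (chartInv V U x)) (chartBase V U)) {X Y : B}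
    (hX : X ∈ (identityDifferential V ρ).range) (hY : Y ∈ (identityDifferential V ρ).range) :
    X * Y - Y * X ∈ (identityDifferential V ρ).range := by
  obtain ⟨v, rfl⟩ := hX
  obtain ⟨L, hL, h⟩ := hasFDerivAt_conj hρ Y
  change identityDifferential V ρ v * Y - Y * identityDifferential V ρ v ∈ _
  rw [← hL]
  refine Submodule.mem_of_hasFDerivAt (Submodule.closed_of_finiteDimensional _) h v
    (Filter.Eventually.of_forall fun t => ?_)
  exact sub_mem (conj_identityDifferential_mem hρ _ hY) (conj_identityDifferential_mem hρ _ hY)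

/-- An element commuting with the differential of a homomorphism from a connected Lie group
commutes with the image of the homomorphism. -/
theorem commute_of_commute_identityDifferential [ConnectedSpace U] [CompleteSpace B] {ρ : U →* B}
    (hρ : DifferentiableAt ℝ (fun x => ρ (chartInv V U x)) (chartBase V U)) {Y : B}
    (hY : ∀ v, Commute (identityDifferential V ρ v) Y) (u : U) : Commute (ρ u) Y := by
  have : IsTopologicalGroup U := topologicalGroup_of_lieGroup 𝓘(ℝ, V) ∞
  let g : U → B := fun u => ρ u * Y * ρ u⁻¹
  have hg1 : g 1 = Y := by simp [g]
  have hg : ∀ u w, g w = ρ u * g (u⁻¹ * w) * ρ u⁻¹ := fun u w => by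
    simp only [g, mul_inv_rev, inv_inv, map_mul]
    have h1 : ρ u * ρ u⁻¹ = 1 := by rw [← map_mul, mul_inv_cancel, map_one]
    calc ρ w * Y * ρ w⁻¹ = (ρ u * ρ u⁻¹) * ρ w * Y * ρ w⁻¹ * (ρ u * ρ u⁻¹) := by rw [h1]; simp
      _ = _ := by simp only [mul_assoc]
  have hD0 : HasFDerivAt (fun x => g (chartInv V U x)) (0 : V →L[ℝ] B) (chartBase V U) := by
    obtain ⟨L, hL, h⟩ := hasFDerivAt_conj hρ Y
    have : L = 0 := by
      ext v
      rw [hL, (hY v).eq, sub_self]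
      rfl
    rwa [this] at h
  -- Translating by `chartInv V U x` carries the vanishing of the derivative from the identity to
  -- every point of the chart, so `g` is constant near `1`. The elements commuting with `Y` then
  -- form an open subgroup, which is everything in a connected group.
  have hD : ∀ x ∈ (extChartAt 𝓘(ℝ, V) (1 : U)).target,
      HasFDerivAt (fun x => g (chartInv V U x)) (0 : V →L[ℝ] B) x := by
    intro x hx
    let α : U → U := fun w => (chartInv V U x)⁻¹ * w
    have hα : ContMDiff 𝓘(ℝ, V) 𝓘(ℝ, V) ∞ α := contMDiff_const.mul contMDiff_id
    have h1 : α (chartInv V U x) = 1 := inv_mul_cancel _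
    have hτ := ((contDiffAt_chartMap hα hx h1).differentiableAt (by simp)).hasFDerivAt
    have h2 : HasFDerivAt (fun x => g (chartInv V U x)) (0 : V →L[ℝ] B) (chartMap V α x) := by
      rw [chartMap_eq_chartBase h1]
      exact hD0
    have h3 := ((h2.comp x hτ).const_mul (ρ (chartInv V U x))).mul_const' (ρ (chartInv V U x)⁻¹)
    refine (h3.congr_of_eventuallyEq ?_).congr_fderiv (by ext; simp)
    filter_upwards [chartInv_chartMap hα.continuous hx h1] with y hy
    rw [Function.comp_apply, hy, hg (chartInv V U x)]
  obtain ⟨ε, hε, hball⟩ := Metric.mem_nhds_iff.mp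
    (extChartAt_target_mem_nhds (I := 𝓘(ℝ, V)) (1 : U))
  have hconst : ∀ x ∈ Metric.ball (chartBase V U) ε, g (chartInv V U x) = Y := by
    intro x hx
    rw [← hg1, ← chartInv_chartBase (V := V)]
    exact (convex_ball (chartBase V U) ε).is_const_of_fderivWithin_eq_zero (𝕜 := ℝ)
      (fun y hy => (hD y (hball hy)).differentiableAt.differentiableWithinAt)
      (fun y hy => (hD y (hball hy)).hasFDerivWithinAt.fderivWithin
        (Metric.isOpen_ball.uniqueDiffWithinAt hy)) hx (Metric.mem_ball_self hε)
  have hcomm : ∀ w, g w = Y → Commute (ρ w) Y := by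
    intro w hw
    have h1 : ρ w⁻¹ * ρ w = 1 := by rw [← map_mul, inv_mul_cancel, map_one]
    rw [Commute, SemiconjBy]
    conv_rhs => rw [← hw]
    rw [mul_assoc _ (ρ w⁻¹), h1, mul_one]
  let N : Subgroup U :=
    { carrier := {w | Commute (ρ w) Y}
      mul_mem' := fun {w w'} (hw : Commute _ _) (hw' : Commute _ _) => by
        change Commute (ρ (w * w')) Y
        rw [map_mul]
        exact hw.mul_left hw'
      one_mem' := by
        change Commute (ρ 1) Y
        rw [map_one]
        exact Commute.one_left Y
      inv_mem' := fun {w} (hw : Commute _ _) => hcomm _ (by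
        simp only [g, inv_inv]
        rw [mul_assoc, ← hw.eq, ← mul_assoc, ← map_mul, inv_mul_cancel, map_one, one_mul]) }
  have hN : (N : Set U) ∈ nhds (1 : U) := by
    have h1 : Metric.ball (chartBase V U) ε ∈ nhds (extChartAt 𝓘(ℝ, V) (1 : U) 1) :=
      Metric.ball_mem_nhds _ hε
    filter_upwards [(continuousAt_extChartAt (I := 𝓘(ℝ, V)) (1 : U)) h1,
      extChartAt_source_mem_nhds (I := 𝓘(ℝ, V)) (1 : U)] with w hw hw'
    refine hcomm w ?_
    rw [← hconst _ hw, chartInv, (extChartAt 𝓘(ℝ, V) (1 : U)).left_inv hw']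
  have hopen := N.isOpen_of_mem_nhds hN
  have huniv : (N : Set U) = Set.univ :=
    IsClopen.eq_univ ⟨N.isClosed_of_isOpen hopen, hopen⟩ ⟨1, N.one_mem⟩
  exact huniv.ge (Set.mem_univ u)

end Infinitesimal

/-! ### Multiplicity one for compact symmetric pairs -/

section SymmetricPair

variable {V U : Type*} [NormedAddCommGroup V] [NormedSpace ℝ V] [FiniteDimensional ℝ V]
  [TopologicalSpace U] [ChartedSpace V U] [Group U] [LieGroup 𝓘(ℝ, V) ∞ U]

omit [FiniteDimensional ℝ V] [LieGroup 𝓘(ℝ, V) ∞ U] in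
theorem chartMap_chartMap {θ : U → U} (hθ : Function.Involutive θ) (hc : Continuous θ)
    (h1 : θ 1 = 1) :
    ∀ᶠ x in nhds (chartBase V U), chartMap V θ (chartMap V θ x) = x := by
  have h2 : θ (chartInv V U (chartBase V U)) = 1 := by rw [chartInv_chartBase, h1]
  filter_upwards [chartInv_chartMap hc chartBase_mem_target h2,
    extChartAt_target_mem_nhds (I := 𝓘(ℝ, V)) (1 : U)] with x hx hx'
  rw [chartMap, hx, hθ]
  exact (extChartAt 𝓘(ℝ, V) (1 : U)).right_inv hx'

/-- Near the identity, the closed subgroup of a symmetric pair contains the points obtained from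
the fixed vectors of the differential of the involution by a chart that linearizes it. -/
theorem IsSymmetricPair.exists_chart {θ : U →* U} {K : Subgroup U}
    (hK : IsSymmetricPair (V := V) θ K) :
    (∀ v, fderiv ℝ (chartMap V θ) (chartBase V U)
      (fderiv ℝ (chartMap V θ) (chartBase V U) v) = v) ∧
    ∃ ζ : V → V, ζ 0 = chartBase V U ∧ HasFDerivAt ζ (ContinuousLinearMap.id ℝ V) 0 ∧
      ∀ᶠ z in nhds (0 : V), fderiv ℝ (chartMap V θ) (chartBase V U) z = z →
        chartInv V U (ζ z) ∈ K := by
  have hc : Continuous θ := hK.contMDiff.continuous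
  set x₀ := chartBase V U
  set τ := chartMap V (θ : U → U)
  set Θ := fderiv ℝ τ x₀
  have h1 : θ (chartInv V U x₀) = 1 := by rw [chartInv_chartBase, map_one]
  have hτ0 : τ x₀ = x₀ := chartMap_eq_chartBase h1
  have hττ : ∀ᶠ x in nhds x₀, τ (τ x) = x := chartMap_chartMap hK.involutive hc (map_one θ)
  have hτc : ∀ᶠ x in nhds x₀, chartInv V U (τ x) = θ (chartInv V U x) :=
    chartInv_chartMap hc chartBase_mem_target h1
  have hτ : HasStrictFDerivAt τ Θ x₀ :=
    (contDiffAt_chartMap hK.contMDiff chartBase_mem_target h1).hasStrictFDerivAt (by simp)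
  have hΘ : ∀ v, Θ (Θ v) = v := by
    have h2 : HasFDerivAt (τ ∘ τ) (Θ.comp Θ) x₀ := by
      refine HasFDerivAt.comp x₀ ?_ hτ.hasFDerivAt
      rw [hτ0]
      exact hτ.hasFDerivAt
    have h3 : HasFDerivAt (τ ∘ τ) (ContinuousLinearMap.id ℝ V) x₀ :=
      (hasFDerivAt_id x₀).congr_of_eventuallyEq hττ
    exact fun v => congrArg (fun L : V →L[ℝ] V => L v) (h2.unique h3)
  -- Averaging over the group generated by the involution linearizes it: `σ ∘ τ = Θ ∘ σ` near `x₀`,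
  -- and `σ` has derivative the identity there since `Θ² = 1`. The required `ζ` is its local
  -- inverse.
  let σ : V → V := fun x => (2⁻¹ : ℝ) • ((x - x₀) + Θ (τ x - x₀))
  have hσ0 : σ x₀ = 0 := by simp [σ, hτ0]
  have hσ : HasStrictFDerivAt σ (ContinuousLinearEquiv.refl ℝ V : V →L[ℝ] V) x₀ := by
    have h2 := (((hasStrictFDerivAt_id x₀).sub_const x₀).add
      (Θ.hasStrictFDerivAt.comp x₀ (hτ.sub_const x₀))).const_smul (2⁻¹ : ℝ)
    refine h2.congr_fderiv ?_
    ext v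
    simp only [smul_apply, add_apply,
      ContinuousLinearMap.comp_apply, hΘ]
    simp [← two_smul ℝ]
  let e := hσ.toOpenPartialHomeomorph σ
  have hx₀ : x₀ ∈ e.source := hσ.mem_toOpenPartialHomeomorph_source
  have h0 : (0 : V) ∈ e.target := hσ0 ▸ e.map_source hx₀
  have hζ0 : e.symm 0 = x₀ := by
    conv_lhs => rw [← hσ0]
    exact e.left_inv hx₀
  have hζ : HasFDerivAt e.symm (ContinuousLinearMap.id ℝ V) 0 := by
    have h2 := hσ.to_localInverse.hasFDerivAt
    rw [hσ0] at h2
    exact h2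
  have hcont : ContinuousAt e.symm 0 := hζ.continuousAt
  have hev : ∀ᶠ x in nhds x₀, (x ∈ e.source ∧ x ∈ (extChartAt 𝓘(ℝ, V) (1 : U)).target) ∧
      τ x ∈ e.source ∧ τ (τ x) = x ∧ chartInv V U (τ x) = θ (chartInv V U x) := by
    have h2 : ∀ᶠ x in nhds x₀, τ x ∈ e.source := by
      refine hτ.continuousAt.eventually_mem ?_
      rw [hτ0]
      exact e.open_source.mem_nhds hx₀
    filter_upwards [e.open_source.mem_nhds hx₀,
      extChartAt_target_mem_nhds (I := 𝓘(ℝ, V)) (1 : U), h2, hττ, hτc] with x a b c d f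
    exact ⟨⟨a, b⟩, c, d, f⟩
  rw [← hζ0] at hev
  obtain ⟨ε, hε, hball⟩ := Metric.eventually_nhds_iff_ball.mp
    ((hcont.eventually hev).and (e.open_target.mem_nhds h0))
  refine ⟨hΘ, e.symm, hζ0, hζ, ?_⟩
  -- `S` is convex, so its image in the fixed points of `θ` is connected and contains `1`; this is
  -- how the hypothesis on the identity component enters.
  let S : Set V := Metric.ball 0 ε ∩ {z | Θ z = z}
  have hS : Convex ℝ S := by
    refine (convex_ball 0 ε).inter fun z hz w hw a b _ _ _ => ?_
    change Θ (a • z + b • w) = _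
    rw [map_add, map_smul, map_smul, hz, hw]
  have hfix : ∀ z ∈ S, θ (chartInv V U (e.symm z)) = chartInv V U (e.symm z) := by
    rintro z ⟨hz, hΘz⟩
    obtain ⟨⟨⟨hs, -⟩, hs', hττz, hτz⟩, htgt⟩ := hball z hz
    set y := e.symm z
    have hσy : σ y = z := e.right_inv htgt
    have h2 : σ (τ y) = σ y := by
      calc σ (τ y) = Θ (σ y) := by
            simp only [σ, hττz, map_smul, map_add, hΘ]
            rw [add_comm]
        _ = σ y := by rw [hσy]; exact hΘz
    have h3 : τ y = y := e.injOn hs' hs h2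
    rw [← hτz, h3]
  have himage : (fun z => chartInv V U (e.symm z)) '' S ⊆ K := by
    refine Set.Subset.trans ?_ hK.identityComponent_le
    refine IsPreconnected.subset_connectedComponentIn (hS.isPreconnected.image _ ?_) ?_ ?_
    · refine ContinuousOn.comp (t := (extChartAt 𝓘(ℝ, V) (1 : U)).target)
        (continuousOn_extChartAt_symm (I := 𝓘(ℝ, V)) (1 : U))
        (e.continuousOn_symm.mono fun z hz => (hball z hz.1).2)
        fun z hz => (hball z hz.1).1.1.2
    · refine ⟨0, ⟨Metric.mem_ball_self hε, map_zero Θ⟩, ?_⟩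
      simp only [hζ0]
      exact chartInv_chartBase
    · rintro _ ⟨z, hz, rfl⟩
      exact hfix z hz
  filter_upwards [Metric.ball_mem_nhds 0 hε] with z hz hΘz
  exact himage ⟨z, ⟨hz, hΘz⟩, rfl⟩

variable {E : Type*} [NormedAddCommGroup E] [InnerProductSpace ℂ E] [FiniteDimensional ℂ E]

/-- A representation on a finite-dimensional space as a homomorphism to the continuous linear
maps. -/
noncomputable def Representation.toCLM (π : Representation ℂ U E) : U →* (E →L[ℂ] E) where
  toFun u := LinearMap.toContinuousLinearMap (π u)
  map_one' := by
    ext v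
    simp
  map_mul' u w := by
    ext v
    simp

omit [TopologicalSpace U] in
theorem Representation.toCLM_apply (π : Representation ℂ U E) (u : U) (v : E) :
    π.toCLM u v = π u v := rfl

theorem IsIrreducibleUnitary.continuous_toCLM {π : Representation ℂ U E}
    (hπ : IsIrreducibleUnitary π) : Continuous π.toCLM :=
  continuous_clm_apply.mpr hπ.continuous

theorem IsIrreducibleUnitary.star_toCLM [CompleteSpace E] {π : Representation ℂ U E}
    (hπ : IsIrreducibleUnitary π) (u : U) : star (π.toCLM u) = π.toCLM u⁻¹ := by
  refine (ContinuousLinearMap.eq_adjoint_iff _ _).mpr (fun v w => ?_) |>.symm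
  rw [Representation.toCLM_apply, Representation.toCLM_apply, ← hπ.unitary u, ← Module.End.mul_apply,
    ← map_mul, mul_inv_cancel, map_one, Module.End.one_apply]

/-- The subspace of operators that act by a scalar on every vector of `W`, the scalar being the
same for all vectors. -/
def scalarOn (W : Submodule ℂ E) : Submodule ℂ (E →L[ℂ] E) where
  carrier := {T | ∃ c : ℂ, ∀ w ∈ W, T w = c • w}
  add_mem' := by
    rintro S T ⟨c, hc⟩ ⟨d, hd⟩
    exact ⟨c + d, fun w hw => by simp [hc w hw, hd w hw, add_smul]⟩
  zero_mem' := ⟨0, by simp⟩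
  smul_mem' := by
    rintro a T ⟨c, hc⟩
    exact ⟨a * c, fun w hw => by simp [hc w hw, mul_smul]⟩

/-- The space of vectors on which `K` acts by a given character is at most one-dimensional in an
irreducible unitary representation of `U`, for a compact symmetric pair `(U, K)`. -/
theorem finrank_chiSubspace_le_one [T2Space U] [SecondCountableTopology U] [CompactSpace U]
    [ConnectedSpace U] [MeasurableSpace U] [BorelSpace U] {θ : U →* U} {K : Subgroup U}
    (hK : IsSymmetricPair (V := V) θ K) (μ : Measure U) [μ.IsHaarMeasure] (χ : K →* ℂ)
    {π : Representation ℂ U E} (hπ : IsIrreducibleUnitary π) :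
    Module.finrank ℂ (chiSubspace χ π) ≤ 1 := by
  have : CompleteSpace E := FiniteDimensional.complete ℂ E
  let W := chiSubspace χ π
  let ρ : U →* (E →L[ℂ] E) × (E →L[ℂ] E) := π.toCLM.prod (π.toCLM.comp θ)
  have hρc : Continuous ρ :=
    hπ.continuous_toCLM.prodMk (hπ.continuous_toCLM.comp hK.contMDiff.continuous)
  have hρ : DifferentiableAt ℝ (fun x => ρ (chartInv V U x)) (chartBase V U) :=
    differentiableAt_comp_chartInv μ ρ hρc
  have hρstar : ∀ u, star (ρ u) = ρ u⁻¹ := fun u => by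
    refine Prod.ext (hπ.star_toCLM u) ?_
    change star (π.toCLM (θ u)) = π.toCLM (θ u⁻¹)
    rw [hπ.star_toCLM, map_inv θ]
  let D := identityDifferential V ρ
  -- The range of `D` is only a real Lie algebra of skew-adjoint pairs; its complex span also
  -- contains the self-adjoint elements whose eigenvalues drive the induction.
  let 𝔤 : Submodule ℂ ((E →L[ℂ] E) × (E →L[ℂ] E)) := Submodule.span ℂ (D.range : Set _)
  have hDswap : ∀ v, (D v).swap = D (fderiv ℝ (chartMap V θ) (chartBase V U) v) := fun v =>
    map_identityDifferential hρ hK.contMDiff (map_one θ)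
      (S := (ContinuousLinearMap.snd ℝ (E →L[ℂ] E) (E →L[ℂ] E)).prod
        (ContinuousLinearMap.fst ℝ (E →L[ℂ] E) (E →L[ℂ] E)))
      (fun u => by simp [ρ, hK.involutive u]) v
  have hDstar : ∀ v, star (D v) = - D v := fun v => by
    have h1 := (hρ.hasFDerivAt.star).unique (by
      simp_rw [hρstar]
      exact hasFDerivAt_comp_chartInv_inv hρ)
    exact congrArg (fun L : V →L[ℝ] (E →L[ℂ] E) × (E →L[ℂ] E) => L v) h1
  have hD𝔤 : ∀ v, D v ∈ 𝔤 := fun v => Submodule.subset_span ⟨v, rfl⟩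
  have h𝔤 : IsSymmetricOperatorAlgebra 𝔤 := by
    refine ⟨fun X hX Y hY => ?_, fun X hX => ?_, fun X hX => ?_⟩
    · induction hX, hY using Submodule.span_induction₂ with
      | mem_mem X Y hX hY => exact Submodule.subset_span (bracket_identityDifferential_mem hρ hX hY)
      | zero_left Y _ => simp
      | zero_right X _ => simp
      | add_left X X' Y _ _ _ h h' =>
        rw [add_mul, mul_add, add_sub_add_comm]
        exact add_mem h h'
      | add_right X Y Y' _ _ _ h h' =>
        rw [add_mul, mul_add, add_sub_add_comm]
        exact add_mem h h'
      | smul_left c X Y _ _ h =>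
        rw [smul_mul_assoc, mul_smul_comm, ← smul_sub]
        exact 𝔤.smul_mem c h
      | smul_right c X Y _ _ h =>
        rw [smul_mul_assoc, mul_smul_comm, ← smul_sub]
        exact 𝔤.smul_mem c h
    · induction hX using Submodule.span_induction with
      | mem X hX =>
        obtain ⟨v, rfl⟩ := hX
        change star (D v) ∈ 𝔤
        rw [hDstar]
        exact neg_mem (hD𝔤 v)
      | zero => simp
      | add X Y _ _ hX hY =>
        rw [star_add]
        exact add_mem hX hY
      | smul c X _ hX =>
        rw [star_smul]
        exact 𝔤.smul_mem _ hX
    · induction hX using Submodule.span_induction with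
      | mem X hX =>
        obtain ⟨v, rfl⟩ := hX
        change (D v).swap ∈ 𝔤
        rw [hDswap]
        exact hD𝔤 _
      | zero => exact zero_mem _
      | add X Y _ _ hX hY => exact add_mem hX hY
      | smul c X _ hX => exact 𝔤.smul_mem c hX
  have hsimple : IsSimpleFor 𝔤 (⊤ : Submodule ℂ E) := by
    refine ⟨fun _ _ _ _ => Submodule.mem_top, fun G _ hG hst => ?_⟩
    -- The projection onto a `𝔤`-stable subspace commutes with the differential, hence with `π(U)`,
    -- so that irreducibility of `π` applies.
    let Q : E →L[ℂ] E := G.starProjection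
    have hcomm : ∀ v, Commute (D v).1 Q := fun v => by
      ext w
      refine Submodule.eq_starProjection_of_mem_orthogonal
        (hst _ (hD𝔤 v) _ (G.starProjection_apply_mem w)) ?_ |>.symm
      change (D v).1 w - (D v).1 (G.starProjection w) ∈ Gᗮ
      rw [← map_sub]
      intro x hx
      rw [← ContinuousLinearMap.adjoint_inner_left]
      refine G.sub_starProjection_mem_orthogonal w _ ?_
      exact hst _ (h𝔤.star _ (hD𝔤 v)) x hx
    have hcomm' : ∀ u, Commute (π.toCLM u) Q := fun u => by
      have h1 := commute_of_commute_identityDifferential hρ (Y := (Q, 0))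
        (fun v => Prod.ext (hcomm v) (by simp)) u
      exact congrArg Prod.fst h1
    let S : Subrepresentation π := ⟨G, fun u v hv => by
      have h1 : π.toCLM u (Q v) = Q (π.toCLM u v) :=
        congrArg (fun T : E →L[ℂ] E => T v) (hcomm' u)
      have h2 : Q v = v := Submodule.starProjection_eq_self_iff.mpr hv
      rw [h2] at h1
      change π.toCLM u v ∈ G
      rw [h1]
      exact G.starProjection_apply_mem _⟩
    have := hπ.irreducible
    rcases eq_bot_or_eq_top S with h | h
    · exact absurd (congrArg Subrepresentation.toSubmodule h) hG
    · exact congrArg Subrepresentation.toSubmodule h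
  obtain ⟨hΘ, ζ, hζ0, hζ, hζK⟩ := hK.exists_chart
  have hscalarK : ∀ k ∈ K, (ρ k).1 ∈ scalarOn W := fun k hk => ⟨χ ⟨k, hk⟩, fun w hw => hw ⟨k, hk⟩⟩
  -- For fixed `v` the curve `t ↦ chartInv V U (ζ (t • v))` runs in `K` for small `t`, so `π` along
  -- it is scalar on `W`; its derivative stays in the closed subspace `scalarOn W`.
  have hfix : ∀ v, fderiv ℝ (chartMap V θ) (chartBase V U) v = v → (D v).1 ∈ scalarOn W := by
    intro v hv
    have h0 : HasFDerivAt (fun z => ρ (chartInv V U (ζ z)))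
        (D.comp (ContinuousLinearMap.id ℝ V)) 0 := by
      refine HasFDerivAt.comp (g := fun x => ρ (chartInv V U x)) (0 : V) ?_ hζ
      rw [hζ0]
      exact hρ.hasFDerivAt
    have h1 := h0.fst
    have h2 := Submodule.mem_of_hasFDerivAt (N := (scalarOn W).restrictScalars ℝ)
      (scalarOn W).closed_of_finiteDimensional h1 v ?_
    · exact h2
    · have h3 : Filter.Tendsto (fun t : ℝ => t • v) (nhds 0) (nhds 0) := by
        have : Continuous fun t : ℝ => t • v := by fun_prop
        simpa using this.tendsto 0
      filter_upwards [h3.eventually hζK] with t ht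
      refine sub_mem (hscalarK _ ?_) (hscalarK _ ?_)
      · rw [zero_add]
        exact ht (by rw [map_smul, hv])
      · rw [hζ0, chartInv_chartBase]
        exact K.one_mem
  have hsum : ∀ X ∈ 𝔤, X.1 + X.2 ∈ scalarOn W := by
    intro X hX
    induction hX using Submodule.span_induction with
    | mem X hX =>
      obtain ⟨v, rfl⟩ := hX
      have h1 := hfix (v + fderiv ℝ (chartMap V θ) (chartBase V U) v) (by rw [map_add, hΘ, add_comm])
      rw [map_add, ← hDswap] at h1
      exact h1
    | zero => exact ⟨0, by simp⟩
    | add X Y _ _ hX hY =>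
      have := add_mem hX hY
      rwa [add_add_add_comm] at this
    | smul c X _ hX =>
      have := (scalarOn W).smul_mem c hX
      rwa [smul_add] at this
  refine finrank_le_one_of_isSimpleFor _ h𝔤 rfl hsimple le_top fun X hX hsw => ?_
  have h1 := (scalarOn W).smul_mem (2⁻¹ : ℂ) (hsum X hX)
  have h2 : X.2 = X.1 := congrArg Prod.fst hsw
  rwa [h2, ← two_smul ℂ, smul_smul, inv_mul_cancel₀ two_ne_zero, one_smul] at h1

end SymmetricPair

/-! ### Integration against a complex measure with a density -/

section VectorMeasure

theorem isFiniteMeasure_variation_withDensityᵥ {X : Type*} [MeasurableSpace X] {ν : Measure X}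
    {f : X → ℂ} (hf : Integrable f ν) : IsFiniteMeasure (ν.withDensityᵥ f).variation := by
  have h : (ν.withDensityᵥ f).variation ≤ ν.withDensity fun x => ‖f x‖ₑ :=
    VectorMeasure.variation_le_of_forall_enorm_le fun s hs => by
      rw [withDensityᵥ_apply hf hs, withDensity_apply _ hs]
      exact enorm_integral_le_lintegral_enorm _
  have := isFiniteMeasure_withDensity hf.hasFiniteIntegral.ne
  exact isFiniteMeasure_of_le _ h

theorem integral_withDensityᵥ_simpleFunc {X : Type*} [MeasurableSpace X] {ν : Measure X}
    {f : X → ℂ} (hf : Integrable f ν) (φ : SimpleFunc X ℂ) :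
    VectorMeasure.integral (ν.withDensityᵥ f) φ (ContinuousLinearMap.mul ℝ ℂ) =
      ∫ x, φ x * f x ∂ν := by
  have := isFiniteMeasure_variation_withDensityᵥ hf
  have hint : ∀ φ : SimpleFunc X ℂ, (ν.withDensityᵥ f).Integrable φ :=
    fun φ => φ.integrable_of_isFiniteMeasure
  have hint' : ∀ φ : SimpleFunc X ℂ, Integrable (fun x => φ x * f x) ν := fun φ => by
    obtain ⟨C, hC⟩ := φ.exists_forall_norm_le
    exact hf.bdd_mul φ.stronglyMeasurable.aestronglyMeasurable (ae_of_all _ hC)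
  induction φ using SimpleFunc.induction with
  | const c hs =>
    rename_i s
    have h0 : ⇑(SimpleFunc.piecewise s hs (SimpleFunc.const X c) (SimpleFunc.const X 0)) =
        s.indicator fun _ => c := by
      ext x
      by_cases hx : x ∈ s <;> simp [hx]
    have h1 : (fun x => s.indicator (fun _ => c) x * f x) =
        s.indicator fun x => c * f x := by
      ext x
      by_cases hx : x ∈ s <;> simp [hx]
    rw [h0, h1, MeasureTheory.integral_indicator hs, integral_const_mul,
      ← withDensityᵥ_apply hf hs]
    exact VectorMeasure.integral_indicator_const c hs
  | add hdisj h1 h2 =>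
    rename_i g h
    rw [SimpleFunc.coe_add, VectorMeasure.integral_add (hint g) (hint h), h1, h2,
      ← MeasureTheory.integral_add (hint' g) (hint' h)]
    simp [add_mul]

/-- Both sides are limits of their values on bounded simple approximations of `φ`, by dominated
convergence; the left side uses that the variation is finite. -/
theorem integral_withDensityᵥ {X : Type*} [MeasurableSpace X] {ν : Measure X}
    {f : X → ℂ} (hf : Integrable f ν) {φ : X → ℂ} (hφ : StronglyMeasurable φ) {C : ℝ}
    (hC : ∀ x, ‖φ x‖ ≤ C) :
    VectorMeasure.integral (ν.withDensityᵥ f) φ (ContinuousLinearMap.mul ℝ ℂ) =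
      ∫ x, φ x * f x ∂ν := by
  have := isFiniteMeasure_variation_withDensityᵥ hf
  by_cases hX : Nonempty X
  swap
  · have : IsEmpty X := not_nonempty_iff.mp hX
    rw [VectorMeasure.integral_of_isEmpty, integral_of_isEmpty]
  have hC0 : 0 ≤ C := (norm_nonneg _).trans (hC hX.some)
  have h1 := VectorMeasure.tendsto_integral_of_dominated_convergence
    (μ := ν.withDensityᵥ f) (B := ContinuousLinearMap.mul ℝ ℂ)
    (f := φ) (fun _ => C)
    (fun n => (hφ.approxBounded C n).stronglyMeasurable.aestronglyMeasurable)
    (integrable_const C) (fun n => ae_of_all _ fun x => hφ.norm_approxBounded_le hC0 n x)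
    (ae_of_all _ fun x => hφ.tendsto_approxBounded_of_norm_le (hC x))
  have h2 := MeasureTheory.tendsto_integral_of_dominated_convergence (μ := ν)
    (F := fun n x => hφ.approxBounded C n x * f x) (f := fun x => φ x * f x)
    (fun x => C * ‖f x‖)
    (fun n => ((hφ.approxBounded C n).stronglyMeasurable.aestronglyMeasurable).mul
      hf.aestronglyMeasurable)
    (hf.norm.const_mul C)
    (fun n => ae_of_all _ fun x => by
      rw [norm_mul]
      exact mul_le_mul_of_nonneg_right (hφ.norm_approxBounded_le hC0 n x) (norm_nonneg _))
    (ae_of_all _ fun x => (hφ.tendsto_approxBounded_of_norm_le (hC x)).mul_const _)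
  simp_rw [integral_withDensityᵥ_simpleFunc hf] at h1
  exact tendsto_nhds_unique h1 h2

end VectorMeasure

/-! ### Factorization of the orbital integral -/

section Orbital

/-- Fubini in a possibly noncommutative algebra, so the order of the factors is kept. -/
theorem integral_prod_mul_of_integrable {X Y B : Type*} [MeasurableSpace X] [MeasurableSpace Y]
    [NormedRing B] [NormedAlgebra ℝ B] [CompleteSpace B] {μ : Measure X} {ν : Measure Y}
    [SFinite μ] [SFinite ν] {F : X → B} {G : Y → B} (hF : Integrable F μ) (hG : Integrable G ν) :
    ∫ p, F p.1 * G p.2 ∂(μ.prod ν) = (∫ x, F x ∂μ) * ∫ y, G y ∂ν := by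
  rw [integral_prod _ (hF.mul_prod hG)]
  simp_rw [fun x => integral_const_mul_of_integrable (c := F x) hG]
  exact integral_mul_const_of_integrable hF

variable {U : Type*} [Group U] {K : Subgroup U}

theorem continuous_ofFn_prod {G : Type*} [Monoid G] [TopologicalSpace G] [ContinuousMul G] (r : ℕ) :
    Continuous fun k : Fin r → G => (List.ofFn k).prod := by
  induction r with
  | zero => simpa using continuous_const
  | succ r ih =>
    simp_rw [List.ofFn_succ, List.prod_cons]
    exact (continuous_apply 0).mul (ih.comp (continuous_pi fun i => continuous_apply i.succ))

theorem orbitalWord_succ {r : ℕ} (a : Fin (r + 1) → U) (k : Fin (r + 2) → K) :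
    orbitalWord a k = k 0 * a 0 * orbitalWord (Fin.tail a) (Fin.tail k) := by
  simp [orbitalWord, List.ofFn_succ, Fin.tail, mul_assoc, ← Fin.succ_last]

variable [TopologicalSpace U] [IsTopologicalGroup U] [SecondCountableTopology U]
  [MeasurableSpace U] [BorelSpace U] [CompactSpace K]

omit [SecondCountableTopology U] [MeasurableSpace U] [BorelSpace U] [CompactSpace K] in
theorem continuous_orbitalWord {r : ℕ} (a : Fin r → U) :
    Continuous fun k : Fin (r + 1) → K => orbitalWord a k := by
  induction r with
  | zero =>
    simp only [orbitalWord, List.ofFn_zero, List.prod_nil, one_mul]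
    fun_prop
  | succ r ih =>
    simp_rw [orbitalWord_succ]
    have h1 : Continuous fun k : Fin (r + 2) → K => Fin.tail k :=
      continuous_pi fun i => continuous_apply _
    have h2 := (ih (Fin.tail a)).comp h1
    fun_prop

variable {B : Type*} [NormedRing B] [NormedAlgebra ℂ B] [CompleteSpace B]

/-- The iterated integral of a homomorphism over the orbital words factors into a product. -/
theorem integral_orbitalWord (μK : Measure K) [IsFiniteMeasure μK]
    {χ : K →* ℂ} (hχ : Continuous χ) {T : U →* B} (hT : Continuous T) {r : ℕ} (a : Fin r → U) :
    ∫ k : Fin (r + 1) → K, (χ (List.ofFn k).prod)⁻¹ • T (orbitalWord a k)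
        ∂(Measure.pi fun _ => μK) =
      (List.ofFn fun i => (∫ k : K, (χ k)⁻¹ • T k ∂μK) * T (a i)).prod *
        ∫ k : K, (χ k)⁻¹ • T k ∂μK := by
  have : SecondCountableTopology K := TopologicalSpace.Subtype.secondCountableTopology _
  have hχ0 : ∀ k, χ k ≠ 0 := fun k => ((Group.isUnit k).map χ).ne_zero
  have hχi : Continuous fun k => (χ k)⁻¹ := hχ.inv₀ hχ0
  have hcont : Continuous fun k : K => (χ k)⁻¹ • T k :=
    hχi.smul (hT.comp continuous_subtype_val)
  induction r with
  | zero =>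
    refine (((measurePreserving_funUnique μK (Fin 1)).symm).integral_comp
      (MeasurableEquiv.measurableEmbedding _) _).symm.trans ?_
    simp [orbitalWord]
  | succ r ih =>
    refine (((measurePreserving_piFinSuccAbove (fun _ : Fin (r + 2) => μK) 0).symm).integral_comp
      (MeasurableEquiv.measurableEmbedding _) _).symm.trans ?_
    have hG : Continuous fun k : Fin (r + 1) → K =>
        (χ (List.ofFn k).prod)⁻¹ • T (orbitalWord (Fin.tail a) k) :=
      (hχi.comp (continuous_ofFn_prod _)).smul (hT.comp (continuous_orbitalWord _))
    have hF : Continuous fun k : K => ((χ k)⁻¹ • T k) * T (a 0) := hcont.mul continuous_const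
    have h1 := integral_prod_mul_of_integrable (μ := μK) (ν := Measure.pi fun _ : Fin (r + 1) => μK)
      hF.integrable_of_compactSpace hG.integrable_of_compactSpace
    rw [ih, integral_mul_const_of_integrable hcont.integrable_of_compactSpace] at h1
    rw [List.ofFn_succ, List.prod_cons, mul_assoc]
    refine Eq.trans ?_ h1
    refine integral_congr_ae (ae_of_all _ fun p => ?_)
    have hk : (MeasurableEquiv.piFinSuccAbove (fun _ : Fin (r + 2) => K) 0).symm p =
        Fin.cons p.1 p.2 := Fin.insertNth_zero' _ _
    change (χ (List.ofFn ((MeasurableEquiv.piFinSuccAbove _ 0).symm p)).prod)⁻¹ •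
      T (orbitalWord a ((MeasurableEquiv.piFinSuccAbove _ 0).symm p)) = _
    rw [hk, orbitalWord_succ, List.ofFn_succ, List.prod_cons]
    simp only [Fin.cons_zero, Fin.cons_succ, Fin.tail_cons, map_mul, mul_inv]
    rw [mul_smul, smul_mul_assoc, smul_mul_assoc, mul_smul_comm]

/-- The trailing `P` is absorbed from the right, one letter at a time; idempotence of `P` is not
needed. -/
theorem prod_ofFn_mul_of_forall_mul_mul {R : Type*} [Ring R] [Algebra ℂ R] {P : R} {r : ℕ}
    (x : Fin r → R) (c : Fin r → ℂ) (h : ∀ i, P * x i * P = c i • P) :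
    (List.ofFn fun i => P * x i).prod * P = (∏ i, c i) • P := by
  induction r with
  | zero => simp
  | succ r ih =>
    rw [List.ofFn_succ, List.prod_cons, mul_assoc,
      ih (fun i => x i.succ) (fun i => c i.succ) fun i => h i.succ, mul_smul_comm, h,
      Fin.prod_univ_succ, smul_smul, mul_comm]

end Orbital

/-! ### The projection onto the `χ`-vectors -/

section Projection

variable {U E : Type*} [Group U] [NormedAddCommGroup E] [InnerProductSpace ℂ E]
  [FiniteDimensional ℂ E] [TopologicalSpace U] [IsTopologicalGroup U] [SecondCountableTopology U]
  [MeasurableSpace U] [BorelSpace U]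

/-- The `χ`-isotypic projection is the orthogonal projection to the line of `χ`-vectors. -/
theorem integral_inv_smul_toCLM {K : Subgroup U} [CompactSpace K] (μK : Measure K)
    [μK.IsHaarMeasure] [IsProbabilityMeasure μK] {χ : K →* ℂ} (hχ : Continuous χ)
    {π : Representation ℂ U E} (hπ : IsIrreducibleUnitary π)
    (hdim : Module.finrank ℂ (chiSubspace χ π) ≤ 1) {e : E} (he : e ∈ chiSubspace χ π)
    (he_norm : ‖e‖ = 1) :
    ∫ k : K, (χ k)⁻¹ • π.toCLM k ∂μK = InnerProductSpace.rankOne ℂ e e := by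
  have : CompleteSpace E := FiniteDimensional.complete ℂ E
  have : SecondCountableTopology K := TopologicalSpace.Subtype.secondCountableTopology _
  have hχ0 : ∀ k, χ k ≠ 0 := fun k => ((Group.isUnit k).map χ).ne_zero
  have hint : Integrable (fun k : K => (χ k)⁻¹ • π.toCLM k) μK :=
    ((hχ.inv₀ hχ0).smul (hπ.continuous_toCLM.comp
      continuous_subtype_val)).integrable_of_compactSpace
  set P := ∫ k : K, (χ k)⁻¹ • π.toCLM k ∂μK with hP
  have hPmem : ∀ v, P v ∈ chiSubspace χ π := by
    intro v k₀
    have h1 : π.toCLM k₀ * P = χ k₀ • P := by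
      rw [hP, ← integral_const_mul_of_integrable hint, ← integral_smul,
        ← integral_mul_left_eq_self (fun k : K => χ k₀ • (χ k)⁻¹ • π.toCLM (k : U)) k₀]
      refine integral_congr_ae (ae_of_all _ fun k => ?_)
      simp only [map_mul, Subgroup.coe_mul, mul_smul_comm]
      rw [smul_smul, mul_inv, mul_inv_cancel_left₀ (hχ0 k₀)]
    exact congrArg (fun T : E →L[ℂ] E => T v) h1
  have he0 : e ≠ 0 := fun h => by simp [h] at he_norm
  have hspan : Submodule.span ℂ {e} = chiSubspace χ π := by
    refine Submodule.eq_of_le_of_finrank_le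
      ((Submodule.span_singleton_le_iff_mem _ _).mpr he) ?_
    rwa [finrank_span_singleton he0]
  -- Since `P v` is a multiple of the unit vector `e`, this inner product determines it.
  have hinner : ∀ v, inner ℂ e (P v) = inner ℂ e v := by
    intro v
    have h1 : inner ℂ e (P v) = ∫ k : K, inner ℂ e ((χ k)⁻¹ • π.toCLM k v) ∂μK := by
      rw [hP, ContinuousLinearMap.integral_apply hint]
      exact (integral_inner (hint.apply_continuousLinearMap v) e).symm
    have h2 : ∀ k : K, inner ℂ e ((χ k)⁻¹ • π.toCLM k v) = inner ℂ e v := by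
      intro k
      have h3 : e = (χ k)⁻¹ • π k e := by
        rw [he k, smul_smul, inv_mul_cancel₀ (hχ0 k), one_smul]
      -- That `χ` has absolute value one is not assumed; it follows from unitarity of `π` on the
      -- nonzero vector `e`.
      have h4 : starRingEnd ℂ (χ k)⁻¹ * (χ k)⁻¹ = 1 := by
        have h5 := hπ.unitary k e e
        rw [he k, inner_smul_left, inner_smul_right, ← mul_assoc,
          mul_eq_right₀ (inner_self_ne_zero.mpr he0)] at h5
        rw [map_inv₀, ← mul_inv, h5, inv_one]
      conv_lhs => rw [h3]
      rw [inner_smul_left, inner_smul_right, ← mul_assoc, h4, one_mul, Representation.toCLM_apply]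
      exact hπ.unitary k e v
    rw [h1, integral_congr_ae (ae_of_all _ h2)]
    simp
  ext v
  obtain ⟨c, hc⟩ := Submodule.mem_span_singleton.mp (hspan ▸ hPmem v)
  rw [InnerProductSpace.rankOne_apply, ← hinner, ← hc, inner_smul_right,
    inner_self_eq_norm_sq_to_K, he_norm]
  simp

end Projection

theorem mainTheorem8
    {V U E : Type*}
    [NormedAddCommGroup V] [NormedSpace ℝ V] [FiniteDimensional ℝ V]
    [TopologicalSpace U] [ChartedSpace V U] [Group U] [LieGroup 𝓘(ℝ, V) ∞ U]
    [T2Space U] [SecondCountableTopology U] [CompactSpace U] [ConnectedSpace U]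
    [MeasurableSpace U] [BorelSpace U]
    [NormedAddCommGroup E] [InnerProductSpace ℂ E] [FiniteDimensional ℂ E]
    (θ : U →* U) (K : Subgroup U) (hK : IsSymmetricPair (V := V) θ K)
    (μU : Measure U) [μU.IsHaarMeasure] [IsProbabilityMeasure μU]
    (μK : Measure K) [μK.IsHaarMeasure] [IsProbabilityMeasure μK]
    (χ : K →* ℂ) (hχ : Continuous χ)
    (π : Representation ℂ U E) (hπ : IsIrreducibleUnitary π)
    (e : E) (he : e ∈ chiSubspace χ π) (he_norm : ‖e‖ = 1)
    {r : ℕ} (a : Fin r → U)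
    (μ : ComplexMeasure U) (hμ : IsOrbitalMeasure μK χ a μ)
    (f : U → ℂ) (hf : IsRadonNikodymDeriv f μ μU) :
    LinearMap.trace ℂ E (fourierTransform μU f π : E →ₗ[ℂ] E) =
      ∏ i, sphericalFunction π e (a i)⁻¹ := by
  have : CompleteSpace E := FiniteDimensional.complete ℂ E
  have : IsTopologicalGroup U := topologicalGroup_of_lieGroup 𝓘(ℝ, V) ∞
  have : CompactSpace K := isCompact_iff_compactSpace.mp hK.isClosed.isCompact
  have : SecondCountableTopology K := TopologicalSpace.Subtype.secondCountableTopology _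
  have hχ0 : ∀ k, χ k ≠ 0 := fun k => ((Group.isUnit k).map χ).ne_zero
  have hT := hπ.continuous_toCLM
  obtain ⟨hfint, rfl⟩ := hf
  let tr : (E →L[ℂ] E) →L[ℂ] ℂ := LinearMap.toContinuousLinearMap
    ((LinearMap.trace ℂ E).comp (ContinuousLinearMap.coeLM ℂ))
  -- The character of `π` is the only test function at which the orbital measure is evaluated.
  let φ : C(U, ℂ) := ⟨fun u => tr (π.toCLM u), tr.continuous.comp hT⟩
  obtain ⟨C, hC⟩ := isCompact_univ.exists_bound_of_continuousOn hT.continuousOn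
  have hfT : Integrable (fun u => f u • π.toCLM u) μU :=
    hfint.smul_bdd C hT.aestronglyMeasurable (ae_of_all _ fun u => hC u trivial)
  have hleft : LinearMap.trace ℂ E (fourierTransform μU f π : E →ₗ[ℂ] E) =
      ∫ u, φ u * f u ∂μU := by
    change tr (∫ u, f u • π.toCLM u ∂μU) = _
    rw [← tr.integral_comp_comm hfT]
    refine integral_congr_ae (ae_of_all _ fun u => ?_)
    simp only [map_smul, smul_eq_mul]
    exact mul_comm _ _
  have hmeasure : ∫ u, φ u * f u ∂μU = orbitalFunctional μK χ a φ := by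
    rw [← hμ φ]
    exact (integral_withDensityᵥ hfint φ.continuous.stronglyMeasurable
      φ.norm_coe_le_norm).symm
  have hword : Integrable (fun k : Fin (r + 1) → K =>
      (χ (List.ofFn k).prod)⁻¹ • π.toCLM (orbitalWord a k)) (Measure.pi fun _ => μK) :=
    (((hχ.inv₀ hχ0).comp (continuous_ofFn_prod _)).smul
      (hT.comp (continuous_orbitalWord a))).integrable_of_compactSpace
  have horbital : orbitalFunctional μK χ a φ =
      tr (∫ k : Fin (r + 1) → K, (χ (List.ofFn k).prod)⁻¹ • π.toCLM (orbitalWord a k)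
        ∂(Measure.pi fun _ => μK)) := by
    rw [← tr.integral_comp_comm hword]
    refine integral_congr_ae (ae_of_all _ fun k => ?_)
    simp only [map_smul, smul_eq_mul]
    exact mul_comm _ _
  have hP := integral_inv_smul_toCLM μK hχ hπ (finrank_chiSubspace_le_one hK μU χ hπ) he he_norm
  rw [hleft, hmeasure, horbital, integral_orbitalWord μK hχ hT, hP,
    prod_ofFn_mul_of_forall_mul_mul _ (fun i => inner ℂ e (π (a i) e)), map_smul]
  · have htr : tr (InnerProductSpace.rankOne ℂ e e) = 1 := by
      change LinearMap.trace ℂ E (InnerProductSpace.rankOne ℂ e e : E →L[ℂ] E) = 1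
      rw [InnerProductSpace.trace_rankOne, inner_self_eq_norm_sq_to_K, he_norm]
      simp
    rw [htr, smul_eq_mul, mul_one]
    refine Finset.prod_congr rfl fun i _ => ?_
    -- Unitarity moves `π(a i)⁻¹` across the inner product; this is why the inverse of `a i` appears
    -- in the formula.
    rw [sphericalFunction, ← hπ.unitary (a i) (π (a i)⁻¹ e), ← Module.End.mul_apply, ← map_mul, mul_inv_cancel,
      map_one, Module.End.one_apply]
  · intro i
    ext v
    simp [Representation.toCLM_apply, smul_smul, mul_comm]
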